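/- Let $p\ge 0$ and $\boldsymbol\gamma,\boldsymbol\beta\in\mathbb R^p$. For a real cost function $C$ on $\{\pm1\}^V$ ($V$ a finite set of qubits), regarded as a diagonal operator, and $B=\sum_{j\in V}X_j$, the QAOA state is $|\boldsymbol\gamma,\boldsymbol\beta\rangle=e^{-i\beta_pB}e^{-i\gamma_pC}\cdots e^{-i\beta_1B}e^{-i\gamma_1C}|s\rangle$ with $|s\rangle=|+\rangle^{\otimes V}$. **MaxCut.** For a finite $(D+1)$-regular graph $G=(V,E)$, $D\ge1$, with at least one edge and girth greater than $2p+1$, prepare the state with $C=-\frac1{\sqrt D}\sum_{(u,v)\in E}Z_uZ_v$, and let $C_{\rm MC}=\sum_{(u,v)\in E}\frac12(1-Z_uZ_v)$. The number $\nu_p(D,\boldsymbol\gamma,\boldsymbol\beta)$ is the one for which, for every such $G$ and every edge $(u,v)$ of $G$, $$\tfrac12\langle\boldsymbol\gamma,\boldsymbol\beta|Z_uZ_v|\boldsymbol\gamma,\boldsymbol\beta\rangle=-\frac{\nu_p(D,\boldsymbol\gamma,\boldsymbol\beta)}{\sqrt D}\quad\text{and}\quad \frac{\langle\boldsymbol\gamma,\boldsymbol\beta|C_{\rm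 MC}|\boldsymbol\gamma,\boldsymbol\beta\rangle}{|E|}=\frac12+\frac{\nu_p(D,\boldsymbol\gamma,\boldsymbol\beta)}{\sqrt D},$$ and $\nu_p(\boldsymbol\gamma,\boldsymbol\beta)=\lim_{D\to\infty}\nu_p(D,\boldsymbol\gamma,\boldsymbol\beta)$. **Sherrington–Kirkpatrick model.** Let $\mu$ be a probability distribution on $\mathbb R$ with mean $0$ and variance $1$, let $J_{ij}$ ($1\le i<j\le n$) be independent with distribution $\mu$, let $C_J^{\rm SK}(\boldsymbol z)=\frac1{\sqrt n}\sum_{1\le i<j\le n}J_{ij}z_iz_j$, and let $|\boldsymbol\gamma,\boldsymbol\beta\rangle_J$ be the state prepared with $C=C_J^{\rm SK}$. Put $$V_p(\boldsymbol\gamma,\boldsymbol\beta)=\lim_{n\to\infty}\mathbb E_J\big[{}_J\langle\boldsymbol\gamma,\boldsymbol\beta|C_J^{\rm SK}/n|\boldsymbol\gamma,\boldsymbol\beta\rangle_J\big].$$ **Theorem.** For every $p$ and all $\boldsymbol\gamma,\boldsymbol\beta\in\mathbb R^p$: numbers $\nu_p(D,\boldsymbol\gamma,\boldsymbol\beta)$,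 $D\ge1$, as above exist (depending neither on the graph nor on the edge), the limit $\nu_p(\boldsymbol\gamma,\boldsymbol\beta)$ exists, the expectations over $J$ and the limit $V_p(\boldsymbol\gamma,\boldsymbol\beta)$ exist for every such $\mu$, and $$V_p(\boldsymbol\gamma,\boldsymbol\beta)=\nu_p(\boldsymbol\gamma,\boldsymbol\beta).$$ -/

import Mathlib

open MeasureTheory Filter Topology

noncomputable section

/-! ### The QAOA state

Basis states of a system of qubits indexed by `V` are the strings `z : V → ℤˣ` of signs `±1`, a state
is a vector of amplitudes `(V → ℤˣ) → ℂ`, and operators are matrices indexed by basis states. -/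

/-- The sign `±1` as a real number. -/
def signVal (s : ℤˣ) : ℝ := ((s : ℤ) : ℝ)

/-- The Pauli operator `X_j`, which flips the sign of qubit `j`. -/
def pauliX {V : Type} [Fintype V] [DecidableEq V] (j : V) :
    Matrix (V → ℤˣ) (V → ℤˣ) ℂ :=
  Matrix.of fun z z' => if z' = Function.update z j (-(z j)) then 1 else 0

/-- The mixing operator `B = ∑ⱼ Xⱼ`. -/
def mixer (V : Type) [Fintype V] [DecidableEq V] : Matrix (V → ℤˣ) (V → ℤˣ) ℂ :=
  ∑ j : V, pauliX j

/-- The operator that is diagonal in the computational basis, with `C |z⟩ = C(z) |z⟩`. -/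
def costOp {V : Type} [Fintype V] [DecidableEq V] (C : (V → ℤˣ) → ℝ) :
    Matrix (V → ℤˣ) (V → ℤˣ) ℂ :=
  Matrix.diagonal fun z => (C z : ℂ)

/-- The uniform superposition `|s⟩ = |+⟩^{⊗ V}`. -/
def plusState (V : Type) [Fintype V] : (V → ℤˣ) → ℂ :=
  fun _ => (((Real.sqrt (2 ^ Fintype.card V))⁻¹ : ℝ) : ℂ)

/-- The state `e^{-iβ_p B} e^{-iγ_p C} ⋯ e^{-iβ_1 B} e^{-iγ_1 C} |s⟩`. The parameters
`γ_1, …, γ_p` are `γ 0, …, γ (p - 1)`, and the last layer acts last. -/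
def qaoaState {V : Type} [Fintype V] [DecidableEq V] (C : (V → ℤˣ) → ℝ) :
    (p : ℕ) → (Fin p → ℝ) → (Fin p → ℝ) → (V → ℤˣ) → ℂ
  | 0, _, _ => plusState V
  | p + 1, γ, β =>
      Matrix.mulVec (NormedSpace.exp ((-(Complex.I * (β (Fin.last p) : ℂ))) • mixer V))
        (Matrix.mulVec (NormedSpace.exp ((-(Complex.I * (γ (Fin.last p) : ℂ))) • costOp C))
          (qaoaState C p (fun k => γ k.castSucc) (fun k => β k.castSucc)))

/-- The expectation `⟨ψ| F |ψ⟩ = ∑_z |ψ(z)|² F(z)` of the diagonal observable `F` in the state `ψ`. -/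
def expect {V : Type} [Fintype V] [DecidableEq V] (ψ : (V → ℤˣ) → ℂ) (F : (V → ℤˣ) → ℝ) : ℝ :=
  ∑ z, ‖ψ z‖ ^ 2 * F z

/-- `expect` is the quantum-mechanical expectation `⟨ψ| F |ψ⟩`. -/
theorem expect_eq_braket {V : Type} [Fintype V] [DecidableEq V] (ψ : (V → ℤˣ) → ℂ)
    (F : (V → ℤˣ) → ℝ) :
    (expect ψ F : ℂ) = dotProduct (star ψ) (Matrix.mulVec (costOp F) ψ) := by
  simp only [expect, costOp, dotProduct, Matrix.mulVec_diagonal, Complex.ofReal_sum,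
    Complex.ofReal_mul, Complex.ofReal_pow, Pi.star_apply]
  refine Finset.sum_congr rfl fun z _ => ?_
  have h : star (ψ z) * ψ z = (‖ψ z‖ : ℂ) ^ 2 := Complex.conj_mul' (ψ z)
  rw [← h]
  ring

/-! ### MaxCut on regular graphs of large girth -/

/-- `z_u z_v` for an edge `{u, v}`. -/
def edgeProd {V : Type} (z : V → ℤˣ) : Sym2 V → ℝ :=
  Sym2.lift ⟨fun u v => signVal (z u) * signVal (z v), fun _ _ => mul_comm _ _⟩

/-- The MaxCut cost function `∑_{(u,v) ∈ E} (1 - z_u z_v) / 2`. -/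
def maxCutCost {V : Type} [Fintype V] [DecidableEq V] (G : SimpleGraph V) [DecidableRel G.Adj]
    (z : V → ℤˣ) : ℝ :=
  ∑ e ∈ G.edgeFinset, (1 / 2 : ℝ) * (1 - edgeProd z e)

/-- The scaled cost function `-(1/√D) ∑_{(u,v) ∈ E} z_u z_v` that drives the QAOA. -/
def driverCost {V : Type} [Fintype V] [DecidableEq V] (G : SimpleGraph V) [DecidableRel G.Adj]
    (D : ℕ) (z : V → ℤˣ) : ℝ :=
  -(1 / Real.sqrt D) * ∑ e ∈ G.edgeFinset, edgeProd z e

/-- `x` is the value `ν_p(D, γ, β)`: on every finite `(D+1)`-regular graph of girth greater than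
`2p+1`, every edge `(u, v)` has `½ ⟨γ,β| Z_u Z_v |γ,β⟩ = -x/√D`, and the expected cut fraction is
`⟨γ,β| C_MC |γ,β⟩ / |E| = ½ + x/√D`. (An edgeless graph is excluded by the choice of an edge.) -/
def IsLargeGirthValue {p : ℕ} (γ β : Fin p → ℝ) (D : ℕ) (x : ℝ) : Prop :=
  ∀ (V : Type) [Fintype V] [DecidableEq V] (G : SimpleGraph V) [DecidableRel G.Adj],
    G.IsRegularOfDegree (D + 1) → ((2 * p + 1 : ℕ) : ℕ∞) < G.egirth →
    ∀ u v : V, G.Adj u v →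
      (1 / 2 : ℝ) * expect (qaoaState (driverCost G D) p γ β)
          (fun z => signVal (z u) * signVal (z v)) = -(x / Real.sqrt D) ∧
      expect (qaoaState (driverCost G D) p γ β) (maxCutCost G) / (G.edgeFinset.card : ℝ)
        = 1 / 2 + x / Real.sqrt D

/-! ### The Sherrington–Kirkpatrick model -/

/-- The pairs `1 ≤ i < j ≤ n`. -/
abbrev Pairs (n : ℕ) : Type := {ij : Fin n × Fin n // ij.1 < ij.2}

/-- The cost function `C_J(z) = (1/√n) ∑_{i<j} J_{ij} z_i z_j`. -/
def skCost (n : ℕ) (J : Pairs n → ℝ) (z : Fin n → ℤˣ) : ℝ :=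
  (1 / Real.sqrt n) * ∑ ij : Pairs n, J ij * (signVal (z ij.1.1) * signVal (z ij.1.2))

/-- The normalized energy `⟨γ,β| C_J / n |γ,β⟩` of the QAOA state prepared with `C_J`. -/
def skEnergy {p : ℕ} (γ β : Fin p → ℝ) (n : ℕ) (J : Pairs n → ℝ) : ℝ :=
  expect (qaoaState (skCost n J) p γ β) (fun z => skCost n J z / n)

/-- The law of independent couplings `J_{ij}`, `i < j`, each with distribution `μ`. -/
def couplingLaw (μ : Measure ℝ) [IsProbabilityMeasure μ] (n : ℕ) : Measure (Pairs n → ℝ) :=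
  Measure.pi fun _ => μ

end

/-! Expanding the state over computational-basis histories turns an expectation into a sum over
contour paths, one forward and one backward history per qubit: a product of single-qubit weights
`siteWeight` times one factor per interacting pair, depending only on the pair's `action`
(`expect_qaoaState`). Two facts make this sum tractable. Since both branches end in the same sign,
the last time does not contribute to the action; and the last mixing layer is unitary. So once the
paths of the qubits in a set U are fixed, the other qubits form a system of their own with one layer
fewer (`contourSum_succ_indicator`).

On a regular graph of large girth this gives a recursion down a tree: the D subtrees hanging from a
qubit are independent, and the path weight is `treeWeight` (`contourSum_edge`). As D grows, the
factor of a single subtree is 1 + t/D + o(1/D), its term of order 1/√D vanishing under a global spin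
flip, so its D-th power tends to an exponential. This defines `limitWeight`, and √D times the edge
correlation tends to `limitCorrelation`.

For the Sherrington–Kirkpatrick model, averaging over J replaces each pair phase by a characteristic
function 1 - x²/(2n) + o(1/n). With k qubits frozen, the remaining ones contribute a product of
about n factors 1 - g/n. Expanding this product over subsets, factorizing each term by induction on
the layers, and dominating the series by unitarity yields the same exponential, hence the same
`limitWeight` (`asymptoticallyIndependent`). The energy carries one extra coupling J on an edge,
whose average against the phase is asymptotically -ix/√n; with about n²/2 pairs the energy tends to
-1/2 times `limitCorrelation`. This is also the MaxCut limit, so only the mean and the variance of μ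
enter. -/

noncomputable section

/-! ### The mixing layer -/

/-- The matrix element `⟨s| e^{-i b X} |t⟩` of a single-qubit mixing layer. -/
def flipKernel (b : ℝ) (s t : ℤˣ) : ℂ :=
  if s = t then Complex.cos b else -(Complex.I * Complex.sin b)

/-- An involution has the spectral projections (1 ± X)/2, so the exponential series splits into
those of exp c and exp (-c). -/
theorem Matrix.exp_smul_of_mul_self_eq_one {n : Type*} [Fintype n] [DecidableEq n]
    (X : Matrix n n ℂ) (hX : X * X = 1) (c : ℂ) :
    NormedSpace.exp (c • X) = Complex.cosh c • (1 : Matrix n n ℂ) + Complex.sinh c • X := by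
  have hpow : ∀ k : ℕ, X ^ k = ((1 : ℂ) ^ k) • ((2⁻¹ : ℂ) • (1 + X))
      + ((-1 : ℂ) ^ k) • ((2⁻¹ : ℂ) • (1 - X)) := by
    intro k
    induction k with
    | zero => ext i j; simp; ring
    | succ k ih =>
      rw [pow_succ, ih]
      simp only [add_mul, sub_mul, smul_mul_assoc, hX, one_mul, one_pow, pow_succ]
      ext i j
      simp
      ring
  have hs : ∀ c : ℂ, HasSum (fun k : ℕ => ((k.factorial : ℂ)⁻¹ * c ^ k)) (Complex.exp c) := by
    intro c
    have := NormedSpace.expSeries_div_hasSum_exp (𝔸 := ℂ) c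
    rw [← Complex.exp_eq_exp_ℂ] at this
    simpa [div_eq_inv_mul] using this
  have h1 := ((hs c).smul_const ((2⁻¹ : ℂ) • (1 + X))).add
    ((hs (-c)).smul_const ((2⁻¹ : ℂ) • (1 - X)))
  rw [NormedSpace.exp_eq_tsum (𝕂 := ℂ)]
  have h2 : (fun k : ℕ => ((k.factorial : ℂ)⁻¹) • (c • X) ^ k) = fun k : ℕ =>
      ((k.factorial : ℂ)⁻¹ * c ^ k) • ((2⁻¹ : ℂ) • (1 + X)) +
      ((k.factorial : ℂ)⁻¹ * (-c) ^ k) • ((2⁻¹ : ℂ) • (1 - X)) := by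
    funext k
    rw [smul_pow, hpow, neg_pow c]
    simp only [smul_add, smul_smul, one_pow]
    congr 2 <;> ring_nf
  simp only [h2, h1.tsum_eq, Complex.cosh, Complex.sinh]
  ext i j
  simp
  ring

variable {V : Type} [Fintype V] [DecidableEq V]

theorem pauliX_mul_apply (j : V) (M : Matrix (V → ℤˣ) (V → ℤˣ) ℂ) (z z' : V → ℤˣ) :
    (pauliX j * M) z z' = M (Function.update z j (-(z j))) z' := by
  simp [Matrix.mul_apply, pauliX]

theorem pauliX_mul_self (j : V) : pauliX j * pauliX j = (1 : Matrix (V → ℤˣ) (V → ℤˣ) ℂ) := by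
  ext z z'
  rw [pauliX_mul_apply]
  simp [pauliX, Matrix.one_apply, eq_comm]

theorem pauliX_commute (i j : V) : Commute (pauliX i) (pauliX j) := by
  by_cases h : i = j
  · rw [h]
  ext z z'
  rw [pauliX_mul_apply, pauliX_mul_apply]
  simp only [pauliX, Matrix.of_apply]
  rw [Function.update_of_ne (Ne.symm h), Function.update_of_ne h, Function.update_comm h]

theorem exp_smul_pauliX (b : ℝ) (j : V) :
    NormedSpace.exp ((-(Complex.I * (b : ℂ))) • pauliX j) =
      Complex.cos b • (1 : Matrix (V → ℤˣ) (V → ℤˣ) ℂ)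
        + (-(Complex.I * Complex.sin b)) • pauliX j := by
  rw [Matrix.exp_smul_of_mul_self_eq_one _ (pauliX_mul_self j), Complex.cosh_neg, Complex.sinh_neg,
    mul_comm Complex.I (b : ℂ), Complex.cosh_mul_I, Complex.sinh_mul_I,
    mul_comm Complex.I (Complex.sin b)]

/-- Flips of different qubits commute, so the exponential factorizes. Using a subset `s`, with the
identity kernel off `s`, allows an induction that adds one qubit at a time. -/
theorem exp_smul_sum_pauliX_apply (b : ℝ) (s : Finset V) (z z' : V → ℤˣ) :
    NormedSpace.exp ((-(Complex.I * (b : ℂ))) • ∑ j ∈ s, pauliX j) z z' =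
      ∏ v, if v ∈ s then flipKernel b (z v) (z' v) else if z v = z' v then 1 else 0 := by
  induction s using Finset.induction_on generalizing z z' with
  | empty =>
    simp [Matrix.one_apply, Finset.prod_ite_zero, funext_iff]
  | insert j s hj ih =>
    rw [Finset.sum_insert hj, smul_add, Matrix.exp_add_of_commute, exp_smul_pauliX, add_mul,
      Matrix.add_apply, smul_mul_assoc, smul_mul_assoc, one_mul, Matrix.smul_apply,
      Matrix.smul_apply, pauliX_mul_apply, ih, ih]
    · rw [← Finset.mul_prod_erase _ _ (Finset.mem_univ j),
        ← Finset.mul_prod_erase Finset.univ (fun v => if v ∈ s then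
          flipKernel b (Function.update z j (-(z j)) v) (z' v) else
          if Function.update z j (-(z j)) v = z' v then (1 : ℂ) else 0) (Finset.mem_univ j),
        ← Finset.mul_prod_erase Finset.univ (fun v => if v ∈ insert j s then
          flipKernel b (z v) (z' v) else if z v = z' v then (1 : ℂ) else 0) (Finset.mem_univ j)]
      have e1 : ∏ v ∈ Finset.univ.erase j, (if v ∈ s then
          flipKernel b (Function.update z j (-(z j)) v) (z' v) else
          if Function.update z j (-(z j)) v = z' v then (1 : ℂ) else 0) =
          ∏ v ∈ Finset.univ.erase j, (if v ∈ s then flipKernel b (z v) (z' v) else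
            if z v = z' v then (1 : ℂ) else 0) := by
        refine Finset.prod_congr rfl fun v hv => ?_
        rw [Function.update_of_ne (Finset.ne_of_mem_erase hv)]
      have e2 : ∏ v ∈ Finset.univ.erase j, (if v ∈ insert j s then flipKernel b (z v) (z' v) else
            if z v = z' v then (1 : ℂ) else 0) =
          ∏ v ∈ Finset.univ.erase j, (if v ∈ s then flipKernel b (z v) (z' v) else
            if z v = z' v then (1 : ℂ) else 0) := by
        refine Finset.prod_congr rfl fun v hv => ?_
        simp [Finset.ne_of_mem_erase hv]
      rw [e1, e2]
      simp only [hj, Finset.mem_insert_self, if_true, if_false, Function.update_self, smul_eq_mul,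
        flipKernel]
      by_cases h : z j = z' j
      · have : -z j ≠ z' j := by
          rw [h]
          rcases Int.units_eq_one_or (z' j) with h2 | h2 <;> simp [h2]
        simp [h, h ▸ this]
      · have : -z j = z' j := by
          rcases Int.units_eq_one_or (z j) with h1 | h1 <;>
            rcases Int.units_eq_one_or (z' j) with h2 | h2 <;> simp_all
        simp [h, this]
    · exact ((Commute.sum_right _ _ _ fun i _ => pauliX_commute j i).smul_left _).smul_right _

/-- The mixing layer acts independently on the qubits. -/
theorem exp_mixer_apply (b : ℝ) (z z' : V → ℤˣ) :
    NormedSpace.exp ((-(Complex.I * (b : ℂ))) • mixer V) z z' =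
      ∏ v, flipKernel b (z v) (z' v) := by
  simpa [mixer] using exp_smul_sum_pauliX_apply b Finset.univ z z'

theorem exp_costOp_mulVec (c : ℝ) (C : (V → ℤˣ) → ℝ) (ψ : (V → ℤˣ) → ℂ) (z : V → ℤˣ) :
    Matrix.mulVec (NormedSpace.exp ((-(Complex.I * (c : ℂ))) • costOp C)) ψ z =
      Complex.exp (-(Complex.I * c * C z)) * ψ z := by
  rw [costOp, ← Matrix.diagonal_smul, Matrix.exp_diagonal, Matrix.mulVec_diagonal]
  rw [Pi.coe_exp, ← Complex.exp_eq_exp_ℂ]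
  simp

/-- `mixer V` is Hermitian, so its imaginary exponential is unitary. -/
theorem sum_norm_sq_exp_mixer_mulVec (b : ℝ) (ψ : (V → ℤˣ) → ℂ) :
    ∑ z, ‖Matrix.mulVec (NormedSpace.exp ((-(Complex.I * (b : ℂ))) • mixer V)) ψ z‖ ^ 2
      = ∑ z, ‖ψ z‖ ^ 2 := by
  set U := NormedSpace.exp ((-(Complex.I * (b : ℂ))) • mixer V) with hU
  have hherm : (mixer V).conjTranspose = mixer V := by
    ext z z'
    simp only [mixer, Matrix.conjTranspose_apply, Matrix.sum_apply, pauliX, Matrix.of_apply,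
      star_sum]
    refine Finset.sum_congr rfl fun j _ => ?_
    have : (z = Function.update z' j (-(z' j))) ↔ (z' = Function.update z j (-(z j))) := by
      constructor <;> rintro rfl <;> simp
    simp only [this]
    split_ifs <;> simp
  have hUU : U.conjTranspose * U = 1 := by
    rw [hU, ← Matrix.exp_conjTranspose, Matrix.conjTranspose_smul, hherm,
      ← Matrix.exp_add_of_commute _ _ ((Commute.refl _).smul_left _ |>.smul_right _), ← add_smul]
    simp
  have key : ∀ φ : (V → ℤˣ) → ℂ, ((∑ z, ‖φ z‖ ^ 2 : ℝ) : ℂ) = dotProduct (star φ) φ := by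
    intro φ
    simp only [dotProduct, Pi.star_apply]
    push_cast
    refine Finset.sum_congr rfl fun z _ => ?_
    exact (Complex.conj_mul' (φ z)).symm
  have : ((∑ z, ‖U.mulVec ψ z‖ ^ 2 : ℝ) : ℂ) = ((∑ z, ‖ψ z‖ ^ 2 : ℝ) : ℂ) := by
    rw [key, key, Matrix.star_mulVec, Matrix.dotProduct_mulVec, Matrix.vecMul_vecMul, hUU,
      Matrix.vecMul_one]
  exact_mod_cast this

end

noncomputable section

/-! ### Sums over trajectories -/

/-- The signs that a qubit takes before and after each of `m` layers, on the forward and on the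
backward branch of the evolution. -/
abbrev ContourPath (m : ℕ) : Type := (Fin (m + 1) → ℤˣ) × (Fin (m + 1) → ℤˣ)

/-- The amplitude with which the mixing layers follow a given trajectory of a single qubit. -/
def siteAmp (β : ℕ → ℝ) : (m : ℕ) → (Fin (m + 1) → ℤˣ) → ℂ
  -- The uniform superposition contributes one factor 1/√2 per qubit.
  | 0, _ => (((Real.sqrt 2)⁻¹ : ℝ) : ℂ)
  | m + 1, x => siteAmp β m (fun t => x t.castSucc) *
      flipKernel (β m) (x (Fin.last (m + 1))) (x (Fin.last m).castSucc)

/-- The weight of a single-qubit contour path; both branches have to end in the same sign. -/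
def siteWeight (β : ℕ → ℝ) (m : ℕ) (a : ContourPath m) : ℂ :=
  if a.1 (Fin.last m) = a.2 (Fin.last m) then
    siteAmp β m a.1 * (starRingEnd ℂ) (siteAmp β m a.2) else 0

/-- The phase angle that a unit coupling between two qubits accumulates along the contour. -/
def action (γ : ℕ → ℝ) (m : ℕ) (a b : ContourPath m) : ℝ :=
  -- The term t = m belongs to no cost layer; it cancels as soon as the branches of both paths meet
  -- at the end, which nonzero site weights enforce.
  ∑ t : Fin (m + 1), γ t * (signVal (a.1 t) * signVal (b.1 t) - signVal (a.2 t) * signVal (b.2 t))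

theorem action_comm (γ : ℕ → ℝ) (m : ℕ) (a b : ContourPath m) :
    action γ m a b = action γ m b a := by
  simp only [action, mul_comm (signVal (a.1 _)), mul_comm (signVal (a.2 _))]

/-- `action` of the two ends of a pair of qubits. -/
def pairAction {V : Type} (γ : ℕ → ℝ) (m : ℕ) (c : V → ContourPath m) : Sym2 V → ℝ :=
  Sym2.lift ⟨fun u v => action γ m (c u) (c v), fun _ _ => action_comm _ _ _ _⟩

@[simp] theorem pairAction_mk {V : Type} (γ : ℕ → ℝ) (m : ℕ) (c : V → ContourPath m) (u v : V) :
    pairAction γ m c s(u, v) = action γ m (c u) (c v) := rfl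

variable {V : Type} [Fintype V] [DecidableEq V]

/-- The sum of `F` over all contour paths of the qubits, weighted by the site weights and by a
function `w e` of the phase angle for every pair `e ∈ E`. -/
def contourSum (γ β : ℕ → ℝ) (E : Finset (Sym2 V)) (w : Sym2 V → ℝ → ℂ) (m : ℕ)
    (F : (V → ContourPath m) → ℂ) : ℂ :=
  ∑ c, (∏ v, siteWeight β m (c v)) * (∏ e ∈ E, w e (pairAction γ m c e)) * F c

/-- The indicator of the event that the qubits in `U` follow the paths prescribed by `a`. -/
def pathIndicator {m : ℕ} (U : Finset V) (a c : V → ContourPath m) : ℂ :=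
  if ∀ u ∈ U, c u = a u then 1 else 0

/-- The QAOA state in which, before every layer and at the end, the qubits of `U` are projected to
the signs prescribed by `a`. -/
def projState (γ β : ℕ → ℝ) (C : (V → ℤˣ) → ℝ) (U : Finset V) :
    (m : ℕ) → (V → Fin (m + 1) → ℤˣ) → (V → ℤˣ) → ℂ
  | 0, a => fun z => if ∀ u ∈ U, z u = a u 0 then plusState V z else 0
  | m + 1, a => fun z => if ∀ u ∈ U, z u = a u (Fin.last (m + 1)) then
      Matrix.mulVec (NormedSpace.exp ((-(Complex.I * (β m : ℂ))) • mixer V))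
        (Matrix.mulVec (NormedSpace.exp ((-(Complex.I * (γ m : ℂ))) • costOp C))
          (projState γ β C U m (fun v t => a v t.castSucc))) z else 0

/-- The angles are now sequences on ℕ, so that removing the last layer leaves them unchanged. -/
theorem qaoaState_eq_projState (γ β : ℕ → ℝ) (C : (V → ℤˣ) → ℝ) (m : ℕ)
    (a : V → Fin (m + 1) → ℤˣ) :
    qaoaState C m (fun k => γ k) (fun k => β k) = projState γ β C ∅ m a := by
  induction m with
  | zero => ext z; simp [qaoaState, projState]
  | succ m ih =>
    ext z
    simp only [qaoaState, projState, Finset.notMem_empty, false_imp_iff, implies_true, if_true,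
      Fin.val_last, Fin.val_castSucc]
    rw [ih (fun v t => a v t.castSucc)]

theorem sum_norm_sq_plusState : ∑ z, ‖plusState V z‖ ^ 2 = 1 := by
  simp [plusState, Real.sq_sqrt]

theorem sum_norm_sq_exp_costOp_mulVec (c : ℝ) (C : (V → ℤˣ) → ℝ) (ψ : (V → ℤˣ) → ℂ) :
    ∑ z, ‖Matrix.mulVec (NormedSpace.exp ((-(Complex.I * (c : ℂ))) • costOp C)) ψ z‖ ^ 2
      = ∑ z, ‖ψ z‖ ^ 2 := by
  refine Finset.sum_congr rfl fun z _ => ?_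
  have : -(Complex.I * (c : ℂ) * (C z : ℂ)) = ((-(c * C z) : ℝ) : ℂ) * Complex.I := by
    push_cast; ring
  rw [exp_costOp_mulVec, norm_mul, this, Complex.norm_exp_ofReal_mul_I, one_mul]

theorem sum_norm_sq_qaoaState (C : (V → ℤˣ) → ℝ) (m : ℕ) (γ β : Fin m → ℝ) :
    ∑ z, ‖qaoaState C m γ β z‖ ^ 2 = 1 := by
  induction m with
  | zero => exact sum_norm_sq_plusState
  | succ m ih =>
    simp only [qaoaState]
    rw [sum_norm_sq_exp_mixer_mulVec, sum_norm_sq_exp_costOp_mulVec, ih]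

/-- Every step is a unitary or a projection, and neither increases the norm. -/
theorem sum_norm_sq_projState_le_one (γ β : ℕ → ℝ) (C : (V → ℤˣ) → ℝ) (U : Finset V) (m : ℕ)
    (a : V → Fin (m + 1) → ℤˣ) : ∑ z, ‖projState γ β C U m a z‖ ^ 2 ≤ 1 := by
  induction m with
  | zero =>
    rw [← sum_norm_sq_plusState (V := V)]
    refine Finset.sum_le_sum fun z _ => ?_
    simp only [projState]
    split_ifs
    · exact le_rfl
    · simp
  | succ m ih =>
    calc ∑ z, ‖projState γ β C U (m + 1) a z‖ ^ 2
        ≤ ∑ z, ‖Matrix.mulVec (NormedSpace.exp ((-(Complex.I * (β m : ℂ))) • mixer V))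
            (Matrix.mulVec (NormedSpace.exp ((-(Complex.I * (γ m : ℂ))) • costOp C))
              (projState γ β C U m (fun v t => a v t.castSucc))) z‖ ^ 2 := by
          refine Finset.sum_le_sum fun z _ => ?_
          simp only [projState]
          split_ifs
          · exact le_rfl
          · simp
      _ ≤ 1 := by
          rw [sum_norm_sq_exp_mixer_mulVec, sum_norm_sq_exp_costOp_mulVec]
          exact ih _

/-- Trajectories of all qubits through `m + 1` layers are trajectories through `m` layers together
with a final configuration. -/
def snocTrajEquiv (V : Type) (m : ℕ) :
    (V → Fin (m + 1) → ℤˣ) × (V → ℤˣ) ≃ (V → Fin (m + 2) → ℤˣ) where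
  toFun p := fun v => Fin.snoc (α := fun _ => ℤˣ) (p.1 v) (p.2 v)
  invFun X := (fun v t => X v t.castSucc, fun v => X v (Fin.last _))
  left_inv p := by simp
  right_inv X := by
    funext v
    exact Fin.snoc_init_self (α := fun _ => ℤˣ) (X v)

/-- Sum over histories: resolve the identity between consecutive layers. The mixing layers factorize
over qubits, the cost layers only give phases, and the projections restrict the histories on `U`. -/
theorem projState_eq_sum (γ β : ℕ → ℝ) (C : (V → ℤˣ) → ℝ) (U : Finset V) (m : ℕ)
    (a : V → Fin (m + 1) → ℤˣ) (z : V → ℤˣ) :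
    projState γ β C U m a z = ∑ X : V → Fin (m + 1) → ℤˣ,
      if (fun v => X v (Fin.last m)) = z ∧ ∀ u ∈ U, X u = a u then
        (∏ v, siteAmp β m (X v)) *
          Complex.exp (-(Complex.I * ∑ t : Fin m, γ t * C (fun v => X v t.castSucc))) else 0 := by
  induction m generalizing z with
  | zero =>
    have : Subsingleton (Fin (0 + 1)) := inferInstanceAs (Subsingleton (Fin 1))
    rw [Fintype.sum_eq_single (fun v _ => z v)]
    · have h2 : Real.sqrt (2 ^ Fintype.card V) = Real.sqrt 2 ^ Fintype.card V := by
        rw [Real.sqrt_eq_iff_mul_self_eq (by positivity) (by positivity), ← mul_pow]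
        simp
      have h3 : (∀ u ∈ U, (fun _ : Fin 1 => z u) = a u) ↔ ∀ u ∈ U, z u = a u 0 := by
        refine forall₂_congr fun u _ => ⟨fun h => by rw [← h], fun h => ?_⟩
        funext t
        rw [Subsingleton.elim t 0, h]
      simp [projState, plusState, siteAmp, h2, h3]
    · intro X hX
      rw [if_neg]
      rintro ⟨h, _⟩
      apply hX
      funext v t
      rw [← h, Subsingleton.elim t (Fin.last 0)]
  | succ m ih =>
    rw [← (snocTrajEquiv V m).sum_comp, Fintype.sum_prod_type]
    have h1 : ∀ (X' : V → Fin (m + 1) → ℤˣ) (z' : V → ℤˣ),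
        ((fun v => snocTrajEquiv V m (X', z') v (Fin.last (m + 1))) = z ∧
          ∀ u ∈ U, snocTrajEquiv V m (X', z') u = a u) ↔
        (z' = z ∧ ((∀ u ∈ U, z u = a u (Fin.last (m + 1))) ∧
          ∀ u ∈ U, X' u = fun t => a u t.castSucc)) := by
      intro X' z'
      have : (fun v => snocTrajEquiv V m (X', z') v (Fin.last (m + 1))) = z' := by
        simp [snocTrajEquiv]
      rw [this]
      refine and_congr_right fun hz => ?_
      subst hz
      rw [← forall₂_and]
      refine forall₂_congr fun u _ => ?_
      constructor
      · intro h
        rw [← h]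
        simp [snocTrajEquiv]
      · rintro ⟨h2, h3⟩
        simp only [snocTrajEquiv, Equiv.coe_fn_mk, h3, h2]
        exact Fin.snoc_init_self (α := fun _ => ℤˣ) (a u)
    simp only [h1]
    simp only [ite_and, Finset.sum_ite_eq', Finset.mem_univ, if_true]
    simp only [projState]
    split_ifs with h2
    swap
    · simp
    rw [Matrix.mulVec, dotProduct]
    simp only [exp_costOp_mulVec, exp_mixer_apply, ih, Finset.mul_sum]
    rw [Finset.sum_comm]
    refine Finset.sum_congr rfl fun X' _ => ?_
    simp only [ite_and]
    rw [Finset.sum_eq_single (fun v => X' v (Fin.last m))]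
    rotate_left
    · intro b _ hb
      simp [hb.symm]
    · simp
    simp only [if_true]
    by_cases h4 : ∀ u ∈ U, X' u = fun t => a u t.castSucc
    · rw [if_pos h4, if_pos h4]
      have e1 : ∀ v, siteAmp β (m + 1) (snocTrajEquiv V m (X', z) v) =
          siteAmp β m (X' v) * flipKernel (β m) (z v) (X' v (Fin.last m)) := by
        intro v
        simp [siteAmp, snocTrajEquiv]
      simp only [Fin.sum_univ_castSucc, Complex.ofReal_add, Complex.ofReal_mul, mul_add, neg_add,
        Complex.exp_add]
      simp only [e1, Finset.prod_mul_distrib]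
      simp only [snocTrajEquiv, Equiv.coe_fn_mk, Fin.snoc_castSucc, Fin.val_castSucc, Fin.val_last]
      rw [show Complex.I * ((γ m : ℂ) * (C fun v => X' v (Fin.last m) : ℂ)) = Complex.I * γ m *
        (C fun v => X' v (Fin.last m) : ℂ) by ring]
      ring
    · rw [if_neg h4, if_neg h4]
      simp

theorem pairAction_eq_sum {V : Type} (γ : ℕ → ℝ) (m : ℕ) (c : V → ContourPath m) (e : Sym2 V) :
    pairAction γ m c e = ∑ t : Fin (m + 1), γ t * (edgeProd (fun v => (c v).1 t) e -
      edgeProd (fun v => (c v).2 t) e) := by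
  induction e using Sym2.ind with
  | _ u v => rfl

/-- The history of the amplitude is the forward branch and that of the conjugated amplitude the
backward branch; the common final configuration z joins them. -/
theorem sum_projState_mul_conj (γ β : ℕ → ℝ) (E : Finset (Sym2 V)) (J : Sym2 V → ℝ)
    (U : Finset V) (m : ℕ) (a b : V → Fin (m + 1) → ℤˣ) (G : (V → ℤˣ) → ℂ) :
    ∑ z, projState γ β (fun z => ∑ e ∈ E, J e * edgeProd z e) U m a z *
      (starRingEnd ℂ) (projState γ β (fun z => ∑ e ∈ E, J e * edgeProd z e) U m b z) * G z =
    contourSum γ β E (fun e x => Complex.exp (-(Complex.I * (J e * x : ℝ)))) m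
      (fun c => (if ∀ u ∈ U, c u = (a u, b u) then 1 else 0) *
        G (fun v => (c v).1 (Fin.last m))) := by
  set C : (V → ℤˣ) → ℝ := fun z => ∑ e ∈ E, J e * edgeProd z e with hC
  rw [contourSum, ← (Equiv.arrowProdEquivProdArrow V _ _).symm.sum_comp, Fintype.sum_prod_type]
  simp only [projState_eq_sum, map_sum, Finset.sum_mul_sum]
  simp only [Finset.sum_mul]
  rw [Finset.sum_comm]
  refine Finset.sum_congr rfl fun X _ => ?_
  rw [Finset.sum_comm]
  refine Finset.sum_congr rfl fun Y _ => ?_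
  rw [Finset.sum_eq_single (fun v => X v (Fin.last m))]
  rotate_left
  · intro z _ hz
    rw [if_neg (fun h => hz h.1.symm)]
    simp
  · simp
  have hpair : (Equiv.arrowProdEquivProdArrow V (fun _ => Fin (m + 1) → ℤˣ)
      (fun _ => Fin (m + 1) → ℤˣ)).symm (X, Y) = fun v => (X v, Y v) := rfl
  simp only [hpair, Prod.mk.injEq, true_and]
  by_cases hXY : (fun v => Y v (Fin.last m)) = fun v => X v (Fin.last m)
  swap
  · have : ∃ v, X v (Fin.last m) ≠ Y v (Fin.last m) := by
      by_contra! h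
      exact hXY (funext fun v => (h v).symm)
    obtain ⟨v, hv⟩ := this
    have h0 : ∏ v, siteWeight β m (X v, Y v) = 0 :=
      Finset.prod_eq_zero (Finset.mem_univ v) (by simp [siteWeight, hv])
    rw [if_neg (fun h : _ ∧ _ => hXY h.1), h0]
    simp
  by_cases hU : ∀ u ∈ U, X u = a u ∧ Y u = b u
  swap
  · rw [if_neg hU]
    by_cases h1 : ∀ u ∈ U, X u = a u
    · rw [if_pos h1, if_neg]
      · simp
      · rintro ⟨_, h2⟩
        exact hU fun u hu => ⟨h1 u hu, h2 u hu⟩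
    · rw [if_neg h1]
      simp
  rw [if_pos hU, if_pos (fun u hu => (hU u hu).1), if_pos ⟨hXY, fun u hu => (hU u hu).2⟩]
  have e1 : ∀ v, siteWeight β m (X v, Y v) =
      siteAmp β m (X v) * (starRingEnd ℂ) (siteAmp β m (Y v)) := by
    intro v
    rw [siteWeight, if_pos (congrFun hXY v).symm]
  -- By `hXY` the term t = m of the action drops out, leaving exactly the m cost layers.
  have e2 : ∑ e ∈ E, -(Complex.I * ((J e * pairAction γ m (fun v => (X v, Y v)) e : ℝ) : ℂ)) =
      -(Complex.I * ((∑ t : Fin m, γ t * C (fun v => X v t.castSucc) : ℝ) : ℂ)) +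
      Complex.I * ((∑ t : Fin m, γ t * C (fun v => Y v t.castSucc) : ℝ) : ℂ) := by
    have : ∀ e, pairAction γ m (fun v => (X v, Y v)) e = ∑ t : Fin m, γ t *
        (edgeProd (fun v => X v t.castSucc) e - edgeProd (fun v => Y v t.castSucc) e) := by
      intro e
      rw [pairAction_eq_sum, Fin.sum_univ_castSucc]
      simp only [hXY]
      simp
    simp only [this, hC]
    push_cast
    simp only [Finset.mul_sum, ← Finset.sum_neg_distrib, ← Finset.sum_add_distrib]
    rw [Finset.sum_comm]
    refine Finset.sum_congr rfl fun t _ => ?_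
    refine Finset.sum_congr rfl fun e _ => ?_
    ring
  simp only [e1, Finset.prod_mul_distrib, ← Complex.exp_sum]
  have e3 : (starRingEnd ℂ) (Complex.exp (-(Complex.I * ((∑ t : Fin m, γ t * C (fun v => Y v t.castSucc) : ℝ) : ℂ)))) =
      Complex.exp (Complex.I * ((∑ t : Fin m, γ t * C (fun v => Y v t.castSucc) : ℝ) : ℂ)) := by
    rw [← Complex.exp_conj, map_neg, map_mul, Complex.conj_I, Complex.conj_ofReal]
    simp
  rw [e2, Complex.exp_add, map_mul, map_prod, e3]
  ring

/-- Expectations of diagonal observables in a QAOA state as contour sums. -/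
theorem expect_qaoaState (γ β : ℕ → ℝ) (E : Finset (Sym2 V)) (J : Sym2 V → ℝ) (m : ℕ)
    (F : (V → ℤˣ) → ℝ) :
    (expect (qaoaState (fun z => ∑ e ∈ E, J e * edgeProd z e) m (fun k => γ k) (fun k => β k)) F : ℂ)
      = contourSum γ β E (fun e x => Complex.exp (-(Complex.I * (J e * x : ℝ)))) m
        (fun c => (F (fun v => (c v).1 (Fin.last m)) : ℂ)) := by
  have := sum_projState_mul_conj γ β E J ∅ m (fun _ _ => 1) (fun _ _ => 1) (fun z => (F z : ℂ))
  simp only [Finset.notMem_empty, false_imp_iff, implies_true, if_true, one_mul] at this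
  rw [← this, qaoaState_eq_projState γ β _ m (fun _ _ => 1), expect]
  push_cast
  refine Finset.sum_congr rfl fun z _ => ?_
  rw [Complex.mul_conj']

/-- Unitarity bounds the weight of the event that some qubits follow prescribed paths. -/
theorem norm_contourSum_indicator_le_one (γ β : ℕ → ℝ) (E : Finset (Sym2 V)) (J : Sym2 V → ℝ)
    (U : Finset V) (m : ℕ) (a : V → ContourPath m) :
    ‖contourSum γ β E (fun e x => Complex.exp (-(Complex.I * (J e * x : ℝ)))) m
      (pathIndicator U a)‖ ≤ 1 := by
  have := sum_projState_mul_conj γ β E J U m (fun v => (a v).1) (fun v => (a v).2) (fun _ => 1)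
  simp only [mul_one] at this
  change _ = contourSum γ β E _ m (pathIndicator U a) at this
  rw [← this]
  set C : (V → ℤˣ) → ℝ := fun z => ∑ e ∈ E, J e * edgeProd z e
  have h1 := sum_norm_sq_projState_le_one γ β C U m (fun v => (a v).1)
  have h2 := sum_norm_sq_projState_le_one γ β C U m (fun v => (a v).2)
  refine (norm_sum_le _ _).trans ?_
  -- The inequality xy ≤ (x² + y²)/2 suffices in place of Cauchy–Schwarz, since both norms are at
  -- most one.
  have : ∀ z, ‖projState γ β C U m (fun v => (a v).1) z *
      (starRingEnd ℂ) (projState γ β C U m (fun v => (a v).2) z)‖ ≤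
      (‖projState γ β C U m (fun v => (a v).1) z‖ ^ 2 +
        ‖projState γ β C U m (fun v => (a v).2) z‖ ^ 2) / 2 := by
    intro z
    rw [norm_mul, RCLike.norm_conj]
    nlinarith [sq_nonneg (‖projState γ β C U m (fun v => (a v).1) z‖ -
      ‖projState γ β C U m (fun v => (a v).2) z‖)]
  refine (Finset.sum_le_sum fun z _ => this z).trans ?_
  rw [← Finset.sum_div, Finset.sum_add_distrib]
  linarith

end

noncomputable section

/-! ### Removing a layer and removing qubits -/

/-- Forget the last layer of a contour path. -/
def truncPath {m : ℕ} (a : ContourPath (m + 1)) : ContourPath m :=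
  (fun t => a.1 t.castSucc, fun t => a.2 t.castSucc)

theorem sum_units_int {M : Type*} [AddCommMonoid M] (f : ℤˣ → M) : ∑ s, f s = f 1 + f (-1) := by
  have : (Finset.univ : Finset ℤˣ) = {1, -1} := rfl
  rw [this, Finset.sum_pair (by decide)]

theorem flipKernel_unitary (b : ℝ) (x y : ℤˣ) :
    ∑ s, flipKernel b s x * (starRingEnd ℂ) (flipKernel b s y) = if x = y then 1 else 0 := by
  have h1 : (1 : ℤˣ) ≠ -1 := by decide
  have h2 : (-1 : ℤˣ) ≠ 1 := by decide
  have h3 := Complex.sin_sq_add_cos_sq (b : ℂ)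
  rw [sum_units_int]
  rcases Int.units_eq_one_or x with rfl | rfl <;> rcases Int.units_eq_one_or y with rfl | rfl <;>
    simp only [flipKernel, h1, h2, if_true, if_false, ← Complex.ofReal_cos, ← Complex.ofReal_sin,
      map_neg, map_mul, Complex.conj_ofReal, Complex.conj_I] <;>
    push_cast <;> ring_nf <;> simp only [Complex.I_sq] <;> linear_combination h3

theorem siteWeight_ne_zero {β : ℕ → ℝ} {m : ℕ} {a : ContourPath m} (h : siteWeight β m a ≠ 0) :
    a.1 (Fin.last m) = a.2 (Fin.last m) := by
  by_contra h'
  exact h (by rw [siteWeight, if_neg h'])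

/-- Causality: signs chosen after the last cost layer cannot influence the phases. -/
theorem action_succ (γ : ℕ → ℝ) {m : ℕ} {a b : ContourPath (m + 1)}
    (ha : a.1 (Fin.last _) = a.2 (Fin.last _)) (hb : b.1 (Fin.last _) = b.2 (Fin.last _)) :
    action γ (m + 1) a b = action γ m (truncPath a) (truncPath b) := by
  rw [action, Fin.sum_univ_castSucc, ha, hb]
  simp [action, truncPath]

theorem action_zero_layers (γ : ℕ → ℝ) {a b : ContourPath 0}
    (ha : a.1 (Fin.last _) = a.2 (Fin.last _)) (hb : b.1 (Fin.last _) = b.2 (Fin.last _)) :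
    action γ 0 a b = 0 := by
  rw [action, Fin.sum_univ_castSucc, ha, hb]
  simp

/-- A contour path through `m + 1` layers is one through `m` layers and two final signs. -/
def snocPathEquiv (m : ℕ) : ContourPath m × (ℤˣ × ℤˣ) ≃ ContourPath (m + 1) where
  toFun p := (Fin.snoc (α := fun _ => ℤˣ) p.1.1 p.2.1, Fin.snoc (α := fun _ => ℤˣ) p.1.2 p.2.2)
  invFun a := (truncPath a, (a.1 (Fin.last _), a.2 (Fin.last _)))
  left_inv p := by simp [truncPath]
  right_inv a := Prod.ext (Fin.snoc_init_self (α := fun _ => ℤˣ) a.1)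
    (Fin.snoc_init_self (α := fun _ => ℤˣ) a.2)

/-- The final mixing layer is unitary, so that summing over the final signs removes it. -/
theorem sum_siteWeight_truncPath_eq (β : ℕ → ℝ) (m : ℕ) (b : ContourPath m) :
    ∑ a : ContourPath (m + 1), (if truncPath a = b then siteWeight β (m + 1) a else 0) =
      siteWeight β m b := by
  rw [← (snocPathEquiv m).sum_comp, Fintype.sum_prod_type]
  have h1 : ∀ b' s, truncPath (snocPathEquiv m (b', s)) = b' := fun b' s =>
    congrArg Prod.fst ((snocPathEquiv m).left_inv (b', s))
  simp only [h1]
  rw [Finset.sum_eq_single b (fun b' _ h => by simp [h]) (by simp), Fintype.sum_prod_type]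
  simp only [if_true]
  have h2 : ∀ s s' : ℤˣ, siteWeight β (m + 1) (snocPathEquiv m (b, (s, s'))) =
      if s = s' then siteAmp β m b.1 * (starRingEnd ℂ) (siteAmp β m b.2) *
        (flipKernel (β m) s (b.1 (Fin.last m)) *
          (starRingEnd ℂ) (flipKernel (β m) s (b.2 (Fin.last m)))) else 0 := by
    intro s s'
    simp only [siteWeight, snocPathEquiv, Equiv.coe_fn_mk, Fin.snoc_last, siteAmp,
      Fin.snoc_castSucc]
    split_ifs with h
    · subst h
      rw [map_mul]
      ring
    · rfl
  simp only [h2, Finset.sum_ite_eq, Finset.mem_univ, if_true]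
  rw [← Finset.mul_sum, flipKernel_unitary, siteWeight]
  split_ifs <;> simp

theorem sum_siteWeight (β : ℕ → ℝ) (m : ℕ) : ∑ a, siteWeight β m a = 1 := by
  induction m with
  | zero =>
    have h : ((Real.sqrt 2 : ℝ) : ℂ)⁻¹ * ((Real.sqrt 2 : ℝ) : ℂ)⁻¹ = 2⁻¹ := by
      rw [← mul_inv, ← Complex.ofReal_mul, Real.mul_self_sqrt (by norm_num)]
      norm_num
    rw [Fintype.sum_prod_type]
    have h2 : ∀ x y : Fin 1 → ℤˣ, siteWeight β 0 (x, y) = if x = y then 2⁻¹ else 0 := by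
      intro x y
      have : x = y ↔ x (Fin.last 0) = y (Fin.last 0) :=
        ⟨fun h => by rw [h], fun h => funext fun t => by rwa [Subsingleton.elim t (Fin.last 0)]⟩
      simp only [siteWeight, siteAmp, this]
      simp [h]
    simp only [h2]
    simp
  | succ m ih =>
    rw [← ih, Finset.sum_congr rfl fun b _ => (sum_siteWeight_truncPath_eq β m b).symm,
      Finset.sum_comm]
    simp

variable {V : Type} [Fintype V] [DecidableEq V]

/-- The pushforward of a product weight under a coordinatewise map is the product of the
pushforwards. It serves to forget the last layer of all qubits at once. -/
theorem sum_prod_mul_comp {A B : Type*} [Fintype A] [Fintype B] [DecidableEq B]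
    (π : A → B) (f : A → ℂ) (g : (V → B) → ℂ) :
    ∑ c : V → A, (∏ v, f (c v)) * g (fun v => π (c v)) =
      ∑ c' : V → B, (∏ v, ∑ a, if π a = c' v then f a else 0) * g c' := by
  classical
  simp only [Finset.prod_univ_sum, Fintype.piFinset_univ, Finset.sum_mul, Finset.prod_ite_zero]
  rw [Finset.sum_comm]
  refine Finset.sum_congr rfl fun c _ => ?_
  rw [Finset.sum_eq_single (fun v => π (c v))]
  · simp
  · intro c' _ hc'
    rw [if_neg, zero_mul]
    intro h
    exact hc' (funext fun v => (h v (Finset.mem_univ v)).symm)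
  · simp

/-- Conditioning in a product weight of total mass one: the coordinates in `U` are frozen at `a` but
still summed as dummies of mass one, so configurations stay indexed by all of `V`. -/
theorem sum_prod_mul_indicator {A : Type*} [Fintype A] [DecidableEq A] (f : A → ℂ)
    (hf : ∑ a, f a = 1) (U : Finset V) (a : V → A) (H : (V → A) → ℂ) :
    ∑ c : V → A, (∏ v, f (c v)) * (H c * if ∀ u ∈ U, c u = a u then 1 else 0) =
      (∏ u ∈ U, f (a u)) * ∑ c : V → A, (∏ v, f (c v)) * H (U.piecewise a c) := by
  have h1 : ∀ c' : V → A, ∑ c : V → A,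
      (∏ v, f (c v) * if v ∈ U then 1 else if c v = c' v then 1 else 0) =
      ∏ v, if v ∈ U then 1 else f (c' v) := by
    intro c'
    have := Finset.prod_univ_sum (fun _ : V => (Finset.univ : Finset A))
      (fun v x => f x * if v ∈ U then 1 else if x = c' v then 1 else 0)
    rw [Fintype.piFinset_univ] at this
    rw [← this]
    refine Finset.prod_congr rfl fun v _ => ?_
    split_ifs <;> simp [hf]
  have h2 : ∀ c c' : V → A, (if U.piecewise a c = c' then (1 : ℂ) else 0) =
      (if ∀ u ∈ U, c' u = a u then 1 else 0) *
        ∏ v, if v ∈ U then 1 else if c v = c' v then 1 else 0 := by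
    intro c c'
    have e : ∀ v, (if v ∈ U then (1 : ℂ) else if c v = c' v then 1 else 0) =
        if (v ∉ U → c v = c' v) then 1 else 0 := by
      intro v
      by_cases hv : v ∈ U <;> simp [hv]
    simp only [e, Finset.prod_ite_zero, Finset.prod_const_one, Finset.mem_univ, true_imp_iff]
    rw [ite_zero_mul_ite_zero, mul_one]
    refine if_congr ?_ rfl rfl
    constructor
    · rintro rfl
      exact ⟨fun u hu => by simp [hu], fun v hv => by simp [hv]⟩
    · rintro ⟨h3, h4⟩
      funext v
      by_cases hv : v ∈ U
      · simp [hv, h3 v hv]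
      · simp [hv, h4 v hv]
  have h3 : ∀ c : V → A, H (U.piecewise a c) =
      ∑ c', (if U.piecewise a c = c' then (1 : ℂ) else 0) * H c' := by
    intro c
    simp
  simp only [h3, h2, Finset.mul_sum]
  rw [Finset.sum_comm]
  refine Finset.sum_congr rfl fun c' _ => ?_
  split_ifs with h
  swap
  · simp
  have h4 : ∀ c : V → A, (∏ u ∈ U, f (a u)) * ((∏ v, f (c v)) * ((1 *
      ∏ v, if v ∈ U then 1 else if c v = c' v then 1 else 0) * H c')) =
      (∏ u ∈ U, f (a u)) * H c' *
        ∏ v, f (c v) * if v ∈ U then 1 else if c v = c' v then 1 else 0 := by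
    intro c
    rw [Finset.prod_mul_distrib]
    ring
  simp only [h4, ← Finset.mul_sum, h1]
  have h5 : ∏ v, f (c' v) = (∏ u ∈ U, f (a u)) * ∏ v, if v ∈ U then 1 else f (c' v) := by
    have : ∏ u ∈ U, f (a u) = ∏ v, if v ∈ U then f (c' v) else 1 := by
      rw [Finset.prod_ite_mem, Finset.univ_inter]
      exact Finset.prod_congr rfl fun u hu => by rw [h u hu]
    rw [this, ← Finset.prod_mul_distrib]
    refine Finset.prod_congr rfl fun v _ => ?_
    split_ifs <;> simp
  rw [h5]
  ring

theorem prod_siteWeight_ne_zero {V : Type} [Fintype V] {β : ℕ → ℝ} {m : ℕ} {c : V → ContourPath m}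
    (h : ∏ v, siteWeight β m (c v) ≠ 0) (v : V) : (c v).1 (Fin.last m) = (c v).2 (Fin.last m) :=
  siteWeight_ne_zero (Finset.prod_ne_zero_iff.1 h v (Finset.mem_univ v))

theorem pairAction_succ {V : Type} (γ : ℕ → ℝ) {m : ℕ} {c : V → ContourPath (m + 1)}
    (hc : ∀ v, (c v).1 (Fin.last _) = (c v).2 (Fin.last _)) (e : Sym2 V) :
    pairAction γ (m + 1) c e = pairAction γ m (fun v => truncPath (c v)) e := by
  induction e using Sym2.ind with
  | _ u v => exact action_succ γ (hc u) (hc v)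

/-- An observable that does not see the last layer has the same expectation without it. -/
theorem contourSum_truncPath (γ β : ℕ → ℝ) (E : Finset (Sym2 V)) (w : Sym2 V → ℝ → ℂ) (m : ℕ)
    (F : (V → ContourPath m) → ℂ) :
    contourSum γ β E w (m + 1) (fun c => F fun v => truncPath (c v)) = contourSum γ β E w m F := by
  have := sum_prod_mul_comp (V := V) truncPath (siteWeight β (m + 1))
    (fun c => (∏ e ∈ E, w e (pairAction γ m c e)) * F c)
  simp only [sum_siteWeight_truncPath_eq] at this
  simp only [contourSum, mul_assoc]
  rw [← this]
  refine Finset.sum_congr rfl fun c _ => ?_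
  by_cases h : ∏ v, siteWeight β (m + 1) (c v) = 0
  · simp [h]
  · simp only [pairAction_succ γ (prod_siteWeight_ne_zero h)]

theorem contourSum_zero_indicator (γ β : ℕ → ℝ) (E : Finset (Sym2 V)) (w : Sym2 V → ℝ → ℂ)
    (U : Finset V) (a : V → ContourPath 0) :
    contourSum γ β E w 0 (pathIndicator U a) =
      (∏ u ∈ U, siteWeight β 0 (a u)) * ∏ e ∈ E, w e 0 := by
  have h := sum_prod_mul_indicator (siteWeight β 0) (sum_siteWeight β 0) U a
    (fun _ => ∏ e ∈ E, w e 0)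
  have h1 : ∑ c : V → ContourPath 0, ∏ v, siteWeight β 0 (c v) = 1 := by
    have := Finset.prod_univ_sum (fun _ : V => (Finset.univ : Finset (ContourPath 0)))
      (fun _ x => siteWeight β 0 x)
    rw [Fintype.piFinset_univ] at this
    rw [← this]
    simp [sum_siteWeight]
  rw [← Finset.sum_mul, h1, one_mul] at h
  rw [← h, contourSum]
  unfold pathIndicator
  refine Finset.sum_congr rfl fun c _ => ?_
  rw [mul_assoc]
  by_cases h0 : ∏ v, siteWeight β 0 (c v) = 0
  · simp [h0]
  · have : ∀ e, pairAction γ 0 c e = 0 := by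
      intro e
      induction e using Sym2.ind with
      | _ u v =>
        exact action_zero_layers γ (prod_siteWeight_ne_zero h0 u) (prod_siteWeight_ne_zero h0 v)
    simp only [this]

/-- A pair that is neither inside nor outside `U` has exactly one end in `U`, so listing it by that
end counts it once. -/
theorem prod_edges_split {M : Type*} [CommMonoid M] (E : Finset (Sym2 V)) (U : Finset V)
    (g : Sym2 V → M) :
    ∏ e ∈ E, g e = (∏ e ∈ E with ∀ x ∈ e, x ∈ U, g e) * ((∏ e ∈ E with ∀ x ∈ e, x ∉ U, g e) *
      ∏ u ∈ U, ∏ x with x ∉ U ∧ s(u, x) ∈ E, g s(u, x)) := by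
  rw [← Finset.prod_filter_mul_prod_filter_not E (fun e => ∀ x ∈ e, x ∈ U),
    ← Finset.prod_filter_mul_prod_filter_not (E.filter fun e => ¬ ∀ x ∈ e, x ∈ U)
      (fun e => ∀ x ∈ e, x ∉ U)]
  congr 1
  congr 1
  · refine Finset.prod_congr ?_ fun _ _ => rfl
    ext e
    simp only [Finset.mem_filter]
    constructor
    · rintro ⟨⟨h1, _⟩, h2⟩
      exact ⟨h1, h2⟩
    · rintro ⟨h1, h2⟩
      refine ⟨⟨h1, fun h3 => ?_⟩, h2⟩
      induction e using Sym2.ind with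
      | _ u v => exact h2 u (Sym2.mem_mk_left u v) (h3 u (Sym2.mem_mk_left u v))
  · rw [Finset.prod_sigma']
    symm
    refine Finset.prod_bij (fun p _ => s(p.1, p.2)) ?_ ?_ ?_ fun _ _ => rfl
    · rintro ⟨u, x⟩ h
      simp only [Finset.mem_sigma, Finset.mem_filter, Finset.mem_univ, true_and] at h
      simp only [Finset.mem_filter, Sym2.mem_iff, forall_eq_or_imp, forall_eq]
      tauto
    · rintro ⟨u, x⟩ h ⟨u', x'⟩ h' heq
      simp only [Finset.mem_sigma, Finset.mem_filter, Finset.mem_univ, true_and] at h h'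
      rcases Sym2.eq_iff.1 heq with ⟨h1, h2⟩ | ⟨h1, h2⟩
      · simp_all
      · simp only at h1 h2
        exact absurd (h1 ▸ h.1) h'.2.1
    · intro e he
      induction e using Sym2.ind with
      | _ u v =>
        simp only [Finset.mem_filter, Sym2.mem_iff, forall_eq_or_imp, forall_eq] at he
        by_cases hu : u ∈ U
        · refine ⟨⟨u, v⟩, ?_, rfl⟩
          simp only [Finset.mem_sigma, Finset.mem_filter, Finset.mem_univ, true_and]
          tauto
        · refine ⟨⟨v, u⟩, ?_, Sym2.eq_swap⟩
          simp only [Finset.mem_sigma, Finset.mem_filter, Finset.mem_univ, true_and]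
          rw [Sym2.eq_swap (a := v)]
          tauto

/-- The pairs in `E` with both ends in `U`. -/
def edgesWithin (E : Finset (Sym2 V)) (U : Finset V) : Finset (Sym2 V) :=
  {e ∈ E | ∀ x ∈ e, x ∈ U}

theorem edgesWithin_subset_sym2 (E : Finset (Sym2 V)) (U : Finset V) : edgesWithin E U ⊆ U.sym2 :=
  fun _ he => Finset.mem_sym2_iff.2 (Finset.mem_filter.1 he).2

/-- Conditioned on the paths of the qubits in `U`, the remaining qubits form a system of their own,
in which the final layer is not visible. -/
theorem contourSum_succ_indicator (γ β : ℕ → ℝ) (E : Finset (Sym2 V)) (w : Sym2 V → ℝ → ℂ) (m : ℕ)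
    (U : Finset V) (a : V → ContourPath (m + 1)) :
    contourSum γ β E w (m + 1) (pathIndicator U a) =
      (∏ u ∈ U, siteWeight β (m + 1) (a u)) *
        (∏ e ∈ edgesWithin E U, w e (pairAction γ (m + 1) a e)) *
        contourSum γ β {e ∈ E | ∀ x ∈ e, x ∉ U} w m (fun c =>
          ∏ u ∈ U, ∏ x with x ∉ U ∧ s(u, x) ∈ E,
            w s(u, x) (action γ m (truncPath (a u)) (c x))) := by
  simp only [contourSum, mul_assoc, pathIndicator, edgesWithin]
  rw [sum_prod_mul_indicator _ (sum_siteWeight β (m + 1)) U a]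
  by_cases h0 : ∏ u ∈ U, siteWeight β (m + 1) (a u) = 0
  · simp [h0]
  congr 1
  have ha : ∀ u ∈ U, (a u).1 (Fin.last _) = (a u).2 (Fin.last _) := fun u hu =>
    siteWeight_ne_zero (Finset.prod_ne_zero_iff.1 h0 u hu)
  -- Pairs that cross or avoid `U` see only truncated paths, so the last layer of the free qubits
  -- can be removed.
  have key := contourSum_truncPath γ β {e ∈ E | ∀ x ∈ e, x ∉ U} w m (fun c =>
          ∏ u ∈ U, ∏ x with x ∉ U ∧ s(u, x) ∈ E,
            w s(u, x) (action γ m (truncPath (a u)) (c x)))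
  simp only [contourSum, mul_assoc] at key
  rw [← key, Finset.mul_sum]
  refine Finset.sum_congr rfl fun c _ => ?_
  by_cases h1 : ∏ v, siteWeight β (m + 1) (c v) = 0
  · simp [h1]
  have hc := prod_siteWeight_ne_zero h1
  rw [prod_edges_split E U]
  have e1 : ∀ e ∈ E.filter (fun e => ∀ x ∈ e, x ∈ U),
      w e (pairAction γ (m + 1) (U.piecewise a c) e) = w e (pairAction γ (m + 1) a e) := by
    intro e he
    have := (Finset.mem_filter.1 he).2
    induction e using Sym2.ind with
    | _ u v => simp [this u (Sym2.mem_mk_left u v), this v (Sym2.mem_mk_right u v)]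
  have e2 : ∀ e ∈ E.filter (fun e => ∀ x ∈ e, x ∉ U),
      w e (pairAction γ (m + 1) (U.piecewise a c) e) = w e (pairAction γ (m + 1) c e) := by
    intro e he
    have := (Finset.mem_filter.1 he).2
    induction e using Sym2.ind with
    | _ u v => simp [this u (Sym2.mem_mk_left u v), this v (Sym2.mem_mk_right u v)]
  have e3 : ∀ u ∈ U, ∀ x ∈ Finset.univ.filter (fun x => x ∉ U ∧ s(u, x) ∈ E),
      w s(u, x) (pairAction γ (m + 1) (U.piecewise a c) s(u, x)) =
        w s(u, x) (action γ m (truncPath (a u)) (truncPath (c x))) := by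
    intro u hu x hx
    have hx' := (Finset.mem_filter.1 hx).2.1
    simp only [pairAction_mk, hu, hx', Finset.piecewise_eq_of_mem, Finset.piecewise_eq_of_notMem,
      not_false_eq_true]
    rw [action_succ γ (ha u hu) (hc x)]
  rw [Finset.prod_congr rfl e1, Finset.prod_congr rfl e2,
    Finset.prod_congr rfl fun u hu => Finset.prod_congr rfl (e3 u hu)]
  ring

end

noncomputable section

/-! ### Expectations of products -/

variable {V : Type} [Fintype V] [DecidableEq V]

theorem contourSum_const_mul (γ β : ℕ → ℝ) (E : Finset (Sym2 V)) (w : Sym2 V → ℝ → ℂ) (m : ℕ)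
    (r : ℂ) (F : (V → ContourPath m) → ℂ) :
    contourSum γ β E w m (fun c => r * F c) = r * contourSum γ β E w m F := by
  simp only [contourSum, Finset.mul_sum]
  exact Finset.sum_congr rfl fun c _ => by ring

theorem contourSum_sum {ι : Type*} (γ β : ℕ → ℝ) (E : Finset (Sym2 V)) (w : Sym2 V → ℝ → ℂ) (m : ℕ)
    (s : Finset ι) (F : ι → (V → ContourPath m) → ℂ) :
    contourSum γ β E w m (fun c => ∑ i ∈ s, F i c) = ∑ i ∈ s, contourSum γ β E w m (F i) := by
  simp only [contourSum, Finset.mul_sum]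
  rw [Finset.sum_comm]

/-- Extend a path assignment from a set of qubits to all qubits. -/
def extendPath {V : Type} [DecidableEq V] {m : ℕ} (U : Finset V) (α : U → ContourPath m) (v : V) : ContourPath m :=
  -- The value off `U` is arbitrary: `pathIndicator U` does not look at it.
  if h : v ∈ U then α ⟨v, h⟩ else (fun _ => 1, fun _ => 1)

theorem forall_eq_extendPath_iff {V : Type} [DecidableEq V] {m : ℕ} (U : Finset V) (α : U → ContourPath m)
    (c : V → ContourPath m) : (∀ u ∈ U, c u = extendPath U α u) ↔ (fun u : U => c u) = α := by
  constructor
  · intro h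
    funext u
    rw [h u u.2, extendPath, dif_pos u.2]
  · rintro rfl u hu
    rw [extendPath, dif_pos hu]

/-- An observable of the paths of the qubits in `U` is a combination of indicators. -/
theorem contourSum_eq_sum_indicator (γ β : ℕ → ℝ) (E : Finset (Sym2 V)) (w : Sym2 V → ℝ → ℂ)
    (m : ℕ) (U : Finset V) (H : (U → ContourPath m) → ℂ) :
    contourSum γ β E w m (fun c => H fun u => c u) = ∑ α : U → ContourPath m,
      H α * contourSum γ β E w m (pathIndicator U (extendPath U α)) := by
  simp only [← contourSum_const_mul]
  rw [← contourSum_sum]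
  congr 1
  funext c
  simp only [pathIndicator, forall_eq_extendPath_iff]
  simp

/-- If the joint weights of the paths of the qubits in `U` nearly factorize, then so do expectations
of products. -/
theorem norm_contourSum_prod_sub_le (γ β : ℕ → ℝ) (E : Finset (Sym2 V)) (w : Sym2 V → ℝ → ℂ)
    (m : ℕ) (U : Finset V) (ρ : ContourPath m → ℂ) (ε : ℝ)
    (h : ∀ a : V → ContourPath m, ‖contourSum γ β E w m
      (pathIndicator U a) - ∏ u ∈ U, ρ (a u)‖ ≤ ε)
    (g : V → ContourPath m → ℂ) :
    ‖contourSum γ β E w m (fun c => ∏ u ∈ U, g u (c u)) - ∏ u ∈ U, ∑ b, ρ b * g u b‖ ≤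
      (∏ u ∈ U, ∑ b, ‖g u b‖) * ε := by
  have h1 : contourSum γ β E w m (fun c => ∏ u ∈ U, g u (c u)) =
      ∑ α : U → ContourPath m, (∏ u : U, g u (α u)) * contourSum γ β E w m
        (pathIndicator U (extendPath U α)) := by
    rw [← contourSum_eq_sum_indicator γ β E w m U (fun α => ∏ u : U, g u (α u))]
    congr 1
    funext c
    exact (Finset.prod_coe_sort U fun u => g u (c u)).symm
  have h2 : ∏ u ∈ U, ∑ b, ρ b * g u b =
      ∑ α : U → ContourPath m, (∏ u : U, g u (α u)) * ∏ u ∈ U, ρ (extendPath U α u) := by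
    rw [← Finset.prod_coe_sort U fun u => ∑ b, ρ b * g u b, Finset.prod_univ_sum,
      Fintype.piFinset_univ]
    refine Finset.sum_congr rfl fun α _ => ?_
    rw [← Finset.prod_coe_sort U fun u => ρ (extendPath U α u), ← Finset.prod_mul_distrib]
    refine Finset.prod_congr rfl fun u _ => ?_
    rw [extendPath, dif_pos u.2, mul_comm]
  have h3 : ∏ u ∈ U, ∑ b, ‖g u b‖ = ∑ α : U → ContourPath m, ∏ u : U, ‖g u (α u)‖ := by
    rw [← Finset.prod_coe_sort U fun u => ∑ b, ‖g u b‖, Finset.prod_univ_sum,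
      Fintype.piFinset_univ]
  rw [h1, h2, h3, ← Finset.sum_sub_distrib, Finset.sum_mul]
  refine (norm_sum_le _ _).trans (Finset.sum_le_sum fun α _ => ?_)
  rw [← mul_sub, norm_mul, norm_prod]
  exact mul_le_mul_of_nonneg_left (h _) (Finset.prod_nonneg fun _ _ => norm_nonneg _)

/-! ### Regular graphs of large girth -/

/-- Shortening the walk to a path adds no edges, so the edge xy closes that path to a cycle. -/
theorem egirth_le_of_walk {V : Type} [DecidableEq V] {G : SimpleGraph V} {x y : V}
    (h : G.Adj x y) (p : G.Walk y x) (hp : s(x, y) ∉ p.edges) :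
    G.egirth ≤ ((p.length + 1 : ℕ) : ℕ∞) := by
  have hc : (SimpleGraph.Walk.cons h p.bypass).IsCycle := by
    rw [SimpleGraph.Walk.cons_isCycle_iff]
    exact ⟨p.bypass_isPath, fun h' => hp (p.edges_bypass_subset_edges h')⟩
  refine (SimpleGraph.egirth_le_length hc).trans ?_
  rw [SimpleGraph.Walk.length_cons]
  exact_mod_cast Nat.succ_le_succ p.length_bypass_le_length

/-- `U` is the boundary of the explored region `A` of a graph which looks like a tree from there:
every qubit of `U` has one neighbour in `A`, and the qubits of `U` are joined by walks of length at
most `L` through `A`. -/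
structure IsTreeFrontier (G : SimpleGraph V) [DecidableRel G.Adj] (A U : Finset V) (L : ℕ) :
    Prop where
  disjoint : ∀ u ∈ U, u ∉ A
  closed : ∀ x ∈ A, ∀ y, G.Adj x y → y ∈ A ∪ U
  parent : ∀ u ∈ U, Finset.card {x ∈ A | G.Adj u x} = 1
  walk : ∀ x ∈ U, ∀ y ∈ U, ∃ p : G.Walk x y, p.length ≤ L ∧
    ∀ e ∈ p.edges, (∀ z ∈ e, z ∈ A ∪ U) ∧ ∃ z ∈ e, z ∈ A

/-- The neighbours of `u` outside of `A ∪ U`. -/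
def children (G : SimpleGraph V) [DecidableRel G.Adj] (A U : Finset V) (u : V) : Finset V :=
  {x | G.Adj u x ∧ x ∉ A ∪ U}

theorem mem_children {G : SimpleGraph V} [DecidableRel G.Adj] {A U : Finset V} {u x : V} :
    x ∈ children G A U u ↔ G.Adj u x ∧ x ∉ A ∪ U := by
  simp [children]

/-- A common child of two distinct frontier qubits would close the walk between them to a cycle of
length at most L + 2. -/
theorem eq_of_mem_children {G : SimpleGraph V} [DecidableRel G.Adj] {A U : Finset V} {L : ℕ}
    (hwalk : ∀ x ∈ U, ∀ y ∈ U, ∃ p : G.Walk x y, p.length ≤ L ∧ ∀ e ∈ p.edges, ∀ z ∈ e, z ∈ A ∪ U)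
    (hL : ((L + 2 : ℕ) : ℕ∞) < G.egirth) {u v x : V} (hu : u ∈ U) (hv : v ∈ U)
    (hxu : x ∈ children G A U u) (hxv : x ∈ children G A U v) : u = v := by
  by_contra huv
  rw [mem_children] at hxu hxv
  obtain ⟨p, hpL, hp⟩ := hwalk v hv u hu
  have h1 : s(u, x) ∉ (SimpleGraph.Walk.cons hxv.1.symm p).edges := by
    rw [SimpleGraph.Walk.edges_cons, List.mem_cons, not_or]
    refine ⟨fun h => ?_, fun h => hxu.2 (hp _ h x (Sym2.mem_mk_right u x))⟩
    rcases Sym2.eq_iff.1 h with ⟨h1, h2⟩ | ⟨h1, h2⟩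
    · exact hxu.1.ne h1
    · exact huv h1
  have h2 := egirth_le_of_walk hxu.1 _ h1
  rw [SimpleGraph.Walk.length_cons] at h2
  have h3 : ((p.length + 1 + 1 : ℕ) : ℕ∞) ≤ ((L + 2 : ℕ) : ℕ∞) := by
    exact_mod_cast by omega
  exact absurd (hL.trans_le (h2.trans h3)) (lt_irrefl _)

/-- Connecting walks grow by one edge at each end, hence L + 2. The hypotheses are weaker than
`IsTreeFrontier G A U L`, so that they also cover the initial edge, whose two ends are adjacent and
have no parent. -/
theorem IsTreeFrontier.next {G : SimpleGraph V} [DecidableRel G.Adj] {A U : Finset V} {L : ℕ}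
    (hA : ∀ x ∈ A, ∀ y, G.Adj x y → y ∈ A ∪ U)
    (hwalk : ∀ x ∈ U, ∀ y ∈ U, ∃ p : G.Walk x y, p.length ≤ L ∧ ∀ e ∈ p.edges, ∀ z ∈ e, z ∈ A ∪ U)
    (hL : ((L + 2 : ℕ) : ℕ∞) < G.egirth) :
    IsTreeFrontier G (A ∪ U) (U.biUnion (children G A U)) (L + 2) where
  disjoint x hx := by
    obtain ⟨u, _, hxu⟩ := Finset.mem_biUnion.1 hx
    exact (mem_children.1 hxu).2
  closed x hx y hxy := by
    by_cases hy : y ∈ A ∪ U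
    · exact Finset.mem_union_left _ hy
    rcases Finset.mem_union.1 hx with hx | hx
    · exact absurd (hA x hx y hxy) hy
    · exact Finset.mem_union_right _ (Finset.mem_biUnion.2 ⟨x, hx, mem_children.2 ⟨hxy, hy⟩⟩)
  parent x hx := by
    obtain ⟨u, hu, hxu⟩ := Finset.mem_biUnion.1 hx
    obtain ⟨h1, h2⟩ := mem_children.1 hxu
    rw [Finset.card_eq_one]
    refine ⟨u, ?_⟩
    ext y
    simp only [Finset.mem_filter, Finset.mem_singleton]
    constructor
    · rintro ⟨hy, hxy⟩
      rcases Finset.mem_union.1 hy with hy | hy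
      · exact absurd (hA y hy x hxy.symm) h2
      · exact eq_of_mem_children hwalk hL hy hu (mem_children.2 ⟨hxy.symm, h2⟩) hxu
    · rintro rfl
      exact ⟨Finset.mem_union_right _ hu, h1.symm⟩
  walk x hx y hy := by
    obtain ⟨u, hu, hxu⟩ := Finset.mem_biUnion.1 hx
    obtain ⟨v, hv, hyv⟩ := Finset.mem_biUnion.1 hy
    obtain ⟨p, hpL, hp⟩ := hwalk u hu v hv
    refine ⟨.cons (mem_children.1 hxu).1.symm (p.concat (mem_children.1 hyv).1), ?_, ?_⟩
    · rw [SimpleGraph.Walk.length_cons, SimpleGraph.Walk.length_concat]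
      omega
    · intro e he
      rw [SimpleGraph.Walk.edges_cons, SimpleGraph.Walk.edges_concat, List.mem_cons,
        List.concat_eq_append, List.mem_append, List.mem_singleton] at he
      rcases he with rfl | he | rfl
      · refine ⟨fun z hz => ?_, u, Sym2.mem_mk_right _ _, Finset.mem_union_right _ hu⟩
        rcases Sym2.mem_iff.1 hz with rfl | rfl
        · exact Finset.mem_union_right _ hx
        · exact Finset.mem_union_left _ (Finset.mem_union_right _ hu)
      · refine ⟨fun z hz => Finset.mem_union_left _ (hp e he z hz), ?_⟩
        induction e using Sym2.ind with
        | _ s t => exact ⟨s, Sym2.mem_mk_left s t, hp _ he s (Sym2.mem_mk_left s t)⟩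
      · refine ⟨fun z hz => ?_, v, Sym2.mem_mk_left _ _, Finset.mem_union_right _ hv⟩
        rcases Sym2.mem_iff.1 hz with rfl | rfl
        · exact Finset.mem_union_left _ (Finset.mem_union_right _ hv)
        · exact Finset.mem_union_right _ hy

/-- The weight of a path of a qubit with `D` subtrees attached to it. -/
def treeWeight (γ β : ℕ → ℝ) (w : ℝ → ℂ) (D : ℕ) : (m : ℕ) → ContourPath m → ℂ
  | 0, a => siteWeight β 0 a
  | m + 1, a => siteWeight β (m + 1) a *
      (∑ b, treeWeight γ β w D m b * w (action γ m (truncPath a) b)) ^ D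

/-- The edges of `G` that avoid `A`. -/
def edgesAvoiding (G : SimpleGraph V) [DecidableRel G.Adj] (A : Finset V) : Finset (Sym2 V) :=
  {e ∈ G.edgeFinset | ∀ x ∈ e, x ∉ A}

theorem edgesAvoiding_subset (G : SimpleGraph V) [DecidableRel G.Adj] (A : Finset V) :
    edgesAvoiding G A ⊆ G.edgeFinset :=
  Finset.filter_subset _ _

theorem edgesAvoiding_filter (G : SimpleGraph V) [DecidableRel G.Adj] (A U : Finset V) :
    {e ∈ edgesAvoiding G A | ∀ x ∈ e, x ∉ U} = edgesAvoiding G (A ∪ U) := by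
  ext e
  simp only [edgesAvoiding, Finset.mem_filter, Finset.mem_union, not_or]
  constructor
  · rintro ⟨⟨h1, h2⟩, h3⟩
    exact ⟨h1, fun x hx => ⟨h2 x hx, h3 x hx⟩⟩
  · rintro ⟨h1, h2⟩
    exact ⟨⟨h1, fun x hx => (h2 x hx).1⟩, fun x hx => (h2 x hx).2⟩

theorem mk_mem_edgesAvoiding {G : SimpleGraph V} [DecidableRel G.Adj] {A : Finset V} {u v : V} :
    s(u, v) ∈ edgesAvoiding G A ↔ G.Adj u v ∧ u ∉ A ∧ v ∉ A := by
  simp [edgesAvoiding]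

theorem edgesWithin_pair {G : SimpleGraph V} [DecidableRel G.Adj] {u v : V} (huv : G.Adj u v) :
    edgesWithin (edgesAvoiding G ∅) {u, v} = {s(u, v)} := by
  ext e
  rw [edgesWithin]
  induction e using Sym2.ind with
  | _ x y =>
    simp only [Finset.mem_filter, mk_mem_edgesAvoiding, Finset.mem_singleton, Sym2.mem_iff,
      forall_eq_or_imp, forall_eq, Sym2.eq_iff, Finset.mem_insert]
    constructor
    · rintro ⟨⟨h, _⟩, h1, h2⟩
      rcases h1 with rfl | rfl <;> rcases h2 with rfl | rfl
      · exact absurd rfl h.ne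
      · exact Or.inl ⟨rfl, rfl⟩
      · exact Or.inr ⟨rfl, rfl⟩
      · exact absurd rfl h.ne
    · rintro (⟨rfl, rfl⟩ | ⟨rfl, rfl⟩)
      · simp [huv]
      · simp [huv.symm]

/-- Children of distinct frontier qubits are distinct and, by `ih`, independent, so each frontier
qubit receives D equal factors. Taking `ih` as a hypothesis serves both the initial edge and the
later frontiers. -/
theorem contourSum_children (γ β : ℕ → ℝ) (w : ℝ → ℂ) (D m L : ℕ) (G : SimpleGraph V)
    [DecidableRel G.Adj] (A U : Finset V)
    (ih : ∀ a : V → ContourPath m,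
      contourSum γ β (edgesAvoiding G (A ∪ U)) (fun _ => w) m
        (pathIndicator (U.biUnion (children G A U)) a) =
      ∏ u ∈ U.biUnion (children G A U), treeWeight γ β w D m (a u))
    (hU : ∀ u ∈ U, u ∉ A)
    (hcard : ∀ u ∈ U, (children G A U u).card = D)
    (hwalk : ∀ x ∈ U, ∀ y ∈ U, ∃ p : G.Walk x y, p.length ≤ L ∧ ∀ e ∈ p.edges, ∀ z ∈ e, z ∈ A ∪ U)
    (hL : ((L + 2 : ℕ) : ℕ∞) < G.egirth) (a : V → ContourPath (m + 1)) :
    contourSum γ β (edgesAvoiding G (A ∪ U)) (fun _ => w) m (fun c =>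
          ∏ u ∈ U, ∏ x with x ∉ U ∧ s(u, x) ∈ edgesAvoiding G A,
            w (action γ m (truncPath (a u)) (c x))) =
      ∏ u ∈ U, (∑ b, treeWeight γ β w D m b * w (action γ m (truncPath (a u)) b)) ^ D := by
  have hdisj : (U : Set V).PairwiseDisjoint (children G A U) := by
    intro u hu v hv huv
    refine Finset.disjoint_left.2 fun x hxu hxv => huv ?_
    exact eq_of_mem_children hwalk hL hu hv hxu hxv
  -- A product over all possible parents avoids choosing one; by uniqueness it reduces to the single
  -- factor of the actual parent.
  set g : V → ContourPath m → ℂ := fun x b =>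
    ∏ u ∈ U with x ∈ children G A U u, w (action γ m (truncPath (a u)) b) with hg
  have hg' : ∀ u ∈ U, ∀ x ∈ children G A U u, ∀ b, g x b = w (action γ m (truncPath (a u)) b) := by
    intro u hu x hx b
    rw [hg]
    have : U.filter (fun u => x ∈ children G A U u) = {u} := by
      ext v
      simp only [Finset.mem_filter, Finset.mem_singleton]
      constructor
      · rintro ⟨hv, hxv⟩
        exact eq_of_mem_children hwalk hL hv hu hxv hx
      · rintro rfl
        exact ⟨hu, hx⟩
    simp only [this, Finset.prod_singleton]
  -- Error zero in the approximate factorization gives exact factorization.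
  have h1 := norm_contourSum_prod_sub_le γ β (edgesAvoiding G (A ∪ U)) (fun _ => w) m
    (U.biUnion (children G A U)) (treeWeight γ β w D m) 0
    (fun a => by rw [ih a, sub_self, norm_zero]) g
  rw [mul_zero, norm_le_zero_iff, sub_eq_zero] at h1
  have h2 : ∀ u ∈ U, Finset.univ.filter (fun x => x ∉ U ∧ s(u, x) ∈ edgesAvoiding G A) =
      children G A U u := by
    intro u hu
    ext x
    simp only [Finset.mem_filter, Finset.mem_univ, true_and, mk_mem_edgesAvoiding, mem_children,
      Finset.mem_union, not_or, hU u hu, not_false_eq_true]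
    tauto
  rw [Finset.prod_biUnion hdisj] at h1
  have h3 : ∀ c : V → ContourPath m, ∏ x ∈ U.biUnion (children G A U), g x (c x) =
      ∏ u ∈ U, ∏ x with x ∉ U ∧ s(u, x) ∈ edgesAvoiding G A,
        w (action γ m (truncPath (a u)) (c x)) := by
    intro c
    rw [Finset.prod_biUnion hdisj]
    refine Finset.prod_congr rfl fun u hu => ?_
    rw [h2 u hu]
    exact Finset.prod_congr rfl fun x hx => hg' u hu x hx _
  simp only [h3] at h1
  rw [h1]
  refine Finset.prod_congr rfl fun u hu => ?_
  have h4 : ∀ x ∈ children G A U u, ∑ b, treeWeight γ β w D m b * g x b =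
      ∑ b, treeWeight γ β w D m b * w (action γ m (truncPath (a u)) b) := by
    intro x hx
    exact Finset.sum_congr rfl fun b _ => by rw [hg' u hu x hx]
  rw [Finset.prod_congr rfl h4, Finset.prod_const, hcard u hu]

/-- Beyond a tree-like frontier the paths of the frontier qubits are independent. -/
theorem contourSum_treeFrontier (γ β : ℕ → ℝ) (w : ℝ → ℂ) (hw : w 0 = 1) (D : ℕ)
    (G : SimpleGraph V) [DecidableRel G.Adj] (hG : G.IsRegularOfDegree (D + 1)) (m : ℕ)
    (A U : Finset V) (L : ℕ) (hf : IsTreeFrontier G A U L)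
    (hL : ((L + 2 * m : ℕ) : ℕ∞) < G.egirth) (a : V → ContourPath m) :
    contourSum γ β (edgesAvoiding G A) (fun _ => w) m
      (pathIndicator U a) = ∏ u ∈ U, treeWeight γ β w D m (a u) := by
  induction m generalizing A U L with
  | zero =>
    rw [contourSum_zero_indicator]
    simp [treeWeight, hw]
  | succ m ih =>
    have hlt : ∀ k, k ≤ L + 2 * (m + 1) → ((k : ℕ) : ℕ∞) < G.egirth := fun k hk =>
      lt_of_le_of_lt (by exact_mod_cast hk) hL
    have hwalk : ∀ x ∈ U, ∀ y ∈ U, ∃ p : G.Walk x y, p.length ≤ L ∧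
        ∀ e ∈ p.edges, ∀ z ∈ e, z ∈ A ∪ U := by
      intro x hx y hy
      obtain ⟨p, h1, h2⟩ := hf.walk x hx y hy
      exact ⟨p, h1, fun e he => (h2 e he).1⟩
    -- Each edge of the connecting walk meets A, so an edge inside U is not among them and would
    -- close a cycle of length at most L + 1.
    have hind : ∀ x ∈ U, ∀ y ∈ U, ¬ G.Adj x y := by
      intro x hx y hy hxy
      obtain ⟨p, hpL, hp⟩ := hf.walk y hy x hx
      have h1 : s(x, y) ∉ p.edges := by
        intro h
        obtain ⟨z, hz, hzA⟩ := (hp _ h).2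
        rcases Sym2.mem_iff.1 hz with rfl | rfl
        · exact hf.disjoint _ hx hzA
        · exact hf.disjoint _ hy hzA
      exact absurd ((hlt (p.length + 1) (by omega)).trans_le (egirth_le_of_walk hxy p h1))
        (lt_irrefl _)
    have hL2 := hlt (L + 2) (by omega)
    -- Of the D + 1 neighbours one is the parent in A and none lies in U.
    have hcard : ∀ u ∈ U, (children G A U u).card = D := by
      intro u hu
      have h1 : (G.neighborFinset u).card = D + 1 := hG u
      have h2 : G.neighborFinset u = {x ∈ A | G.Adj u x} ∪ children G A U u := by
        ext x
        simp only [SimpleGraph.mem_neighborFinset, Finset.mem_union, Finset.mem_filter,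
          mem_children]
        constructor
        · intro h
          by_cases hx : x ∈ A
          · exact Or.inl ⟨hx, h⟩
          · refine Or.inr ⟨h, ?_⟩
            rintro (h' | h')
            · exact hx h'
            · exact hind u hu x h' h
        · rintro (⟨_, h⟩ | ⟨h, _⟩) <;> exact h
      rw [h2, Finset.card_union_of_disjoint, hf.parent u hu] at h1
      · omega
      · refine Finset.disjoint_left.2 fun x hx hx' => ?_
        exact (mem_children.1 hx').2 (Finset.mem_union_left _ (Finset.mem_filter.1 hx).1)
    rw [contourSum_succ_indicator, edgesAvoiding_filter, contourSum_children γ β w D m L G A U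
      (fun a => ih _ _ _ (IsTreeFrontier.next hf.closed hwalk hL2)
        (hlt (L + 2 + 2 * m) (by omega)) a) hf.disjoint hcard hwalk hL2]
    rw [edgesWithin, Finset.filter_false_of_mem, Finset.prod_empty, mul_one, ← Finset.prod_mul_distrib]
    · rfl
    · intro e he h
      induction e using Sym2.ind with
      | _ x y =>
        exact hind x (h x (Sym2.mem_mk_left x y)) y (h y (Sym2.mem_mk_right x y))
          (mk_mem_edgesAvoiding.1 he).1

/-- The joint weight of the paths of the two ends of an edge in a regular graph of large girth. -/
theorem contourSum_edge (γ β : ℕ → ℝ) (w : ℝ → ℂ) (hw : w 0 = 1) (D : ℕ)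
    (G : SimpleGraph V) [DecidableRel G.Adj] (hG : G.IsRegularOfDegree (D + 1)) (p : ℕ)
    (hp : ((2 * p + 1 : ℕ) : ℕ∞) < G.egirth) {u v : V} (huv : G.Adj u v)
    (a : V → ContourPath p) :
    contourSum γ β G.edgeFinset (fun _ => w) p
      (pathIndicator (({u, v} : Finset V)) a) =
      treeWeight γ β w D p (a u) * treeWeight γ β w D p (a v) * w (action γ p (a u) (a v)) := by
  cases p with
  | zero =>
    rw [contourSum_zero_indicator, Finset.prod_pair huv.ne]
    simp only [treeWeight, hw, Finset.prod_const_one, mul_one]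
    by_cases h1 : siteWeight β 0 (a u) = 0
    · simp [h1]
    by_cases h2 : siteWeight β 0 (a v) = 0
    · simp [h2]
    rw [action_zero_layers γ (siteWeight_ne_zero h1) (siteWeight_ne_zero h2), hw, mul_one]
  | succ m =>
    have hlt : ∀ k, k ≤ 2 * (m + 1) + 1 → ((k : ℕ) : ℕ∞) < G.egirth := fun k hk =>
      lt_of_le_of_lt (by exact_mod_cast hk) hp
    set U : Finset V := {u, v} with hU
    have hE : G.edgeFinset = edgesAvoiding G ∅ := by simp [edgesAvoiding]
    have hA : ∀ x ∈ (∅ : Finset V), ∀ y, G.Adj x y → y ∈ ∅ ∪ U := by simp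
    have hwalk : ∀ x ∈ U, ∀ y ∈ U, ∃ p : G.Walk x y, p.length ≤ 1 ∧
        ∀ e ∈ p.edges, ∀ z ∈ e, z ∈ ∅ ∪ U := by
      have hadj : ∀ x ∈ U, ∀ y ∈ U, G.Adj x y → ∃ p : G.Walk x y, p.length ≤ 1 ∧
          ∀ e ∈ p.edges, ∀ z ∈ e, z ∈ ∅ ∪ U := by
        intro x hx y hy h
        refine ⟨h.toWalk, by simp, fun e he z hz => ?_⟩
        simp only [SimpleGraph.Adj.toWalk, SimpleGraph.Walk.edges_cons, SimpleGraph.Walk.edges_nil,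
          List.mem_singleton] at he
        subst he
        rw [Finset.empty_union]
        rcases Sym2.mem_iff.1 hz with rfl | rfl
        · exact hx
        · exact hy
      have hnil : ∀ x ∈ U, ∃ p : G.Walk x x, p.length ≤ 1 ∧
          ∀ e ∈ p.edges, ∀ z ∈ e, z ∈ ∅ ∪ U := fun x _ => ⟨.nil, by simp, by simp⟩
      intro x hx y hy
      rcases Finset.mem_insert.1 hx with rfl | hx' <;> rcases Finset.mem_insert.1 hy with rfl | hy'
      · exact hnil _ hx
      · rw [Finset.mem_singleton] at hy'
        subst hy'
        exact hadj _ hx _ hy huv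
      · rw [Finset.mem_singleton] at hx'
        subst hx'
        exact hadj _ hx _ hy huv.symm
      · rw [Finset.mem_singleton] at hx' hy'
        subst hx' hy'
        exact hnil _ hx
    have hcard : ∀ x ∈ U, (children G ∅ U x).card = D := by
      have h0 : ∀ x y, G.Adj x y → U = {x, y} → (children G ∅ U x).card = D := by
        intro x y hxy hUxy
        have h1 : (G.neighborFinset x).card = D + 1 := hG x
        have h2 : G.neighborFinset x = insert y (children G ∅ U x) := by
          ext t
          simp only [SimpleGraph.mem_neighborFinset, Finset.mem_insert, mem_children, hUxy,
            Finset.empty_union, Finset.mem_singleton, not_or]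
          constructor
          · intro h
            by_cases hty : t = y
            · exact Or.inl hty
            · exact Or.inr ⟨h, h.ne', hty⟩
          · rintro (rfl | ⟨h, _⟩)
            · exact hxy
            · exact h
        rw [h2, Finset.card_insert_of_notMem] at h1
        · omega
        · simp [mem_children, hUxy]
      intro x hx
      rcases Finset.mem_insert.1 hx with rfl | hx'
      · exact h0 _ _ huv hU
      · rw [Finset.mem_singleton] at hx'
        subst hx'
        exact h0 _ _ huv.symm (by rw [hU, Finset.pair_comm])
    -- The ends of the edge are joined by walks of length at most 1 and their children by walks of
    -- length at most 3; the remaining m layers need girth above 3 + 2m = 2p + 1, which is the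
    -- assumption.
    have hL2 := hlt (1 + 2) (by omega)
    rw [hE, contourSum_succ_indicator, edgesAvoiding_filter, contourSum_children γ β w D m 1 G ∅ U
      (fun a => contourSum_treeFrontier γ β w hw D G hG m _ _ _
        (IsTreeFrontier.next hA hwalk hL2) (hlt (1 + 2 + 2 * m) (by omega)) a)
        (by simp) hcard hwalk hL2]
    rw [hU, edgesWithin_pair huv, Finset.prod_singleton, pairAction_mk, Finset.prod_pair huv.ne,
      Finset.prod_pair huv.ne]
    simp only [treeWeight]
    ring

end

noncomputable section

/-! ### The limit of large degree -/

theorem signVal_neg (s : ℤˣ) : signVal (-s) = -signVal s := by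
  simp [signVal]

theorem siteAmp_neg (β : ℕ → ℝ) (m : ℕ) (x : Fin (m + 1) → ℤˣ) :
    siteAmp β m (-x) = siteAmp β m x := by
  induction m with
  | zero => rfl
  | succ m ih =>
    simp only [siteAmp, flipKernel, Pi.neg_apply, neg_inj]
    have : (fun t : Fin (m + 1) => -x t.castSucc) = -fun t => x t.castSucc := rfl
    rw [this, ih]

theorem siteWeight_neg (β : ℕ → ℝ) (m : ℕ) (a : ContourPath m) :
    siteWeight β m (-a) = siteWeight β m a := by
  simp only [siteWeight, Prod.fst_neg, Prod.snd_neg, Pi.neg_apply, neg_inj, siteAmp_neg]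

theorem action_neg_left (γ : ℕ → ℝ) (m : ℕ) (a b : ContourPath m) :
    action γ m (-a) b = -action γ m a b := by
  simp only [action, Prod.fst_neg, Prod.snd_neg, Pi.neg_apply, signVal_neg]
  rw [← Finset.sum_neg_distrib]
  exact Finset.sum_congr rfl fun t _ => by ring

theorem action_neg_right (γ : ℕ → ℝ) (m : ℕ) (a b : ContourPath m) :
    action γ m a (-b) = -action γ m a b := by
  rw [action_comm, action_neg_left, action_comm]

/-- The action is odd in each argument, so the flip of `a` is absorbed by flipping the summation
variable. -/
theorem treeWeight_neg (γ β : ℕ → ℝ) (w : ℝ → ℂ) (D m : ℕ) (a : ContourPath m) :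
    treeWeight γ β w D m (-a) = treeWeight γ β w D m a := by
  induction m with
  | zero => exact siteWeight_neg β 0 a
  | succ m ih =>
    simp only [treeWeight, siteWeight_neg]
    congr 2
    rw [← Equiv.sum_comp (Equiv.neg (ContourPath m))]
    refine Finset.sum_congr rfl fun b _ => ?_
    have : truncPath (-a) = -truncPath a := rfl
    rw [Equiv.neg_apply, ih, this, action_neg_left, action_neg_right, neg_neg]

theorem sum_eq_zero_of_odd {m : ℕ} (f : ContourPath m → ℂ) (hf : ∀ a, f (-a) = -f a) :
    ∑ a, f a = 0 := by
  have h : ∑ a, f a = -∑ a, f a := by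
    conv_lhs => rw [← Equiv.sum_comp (Equiv.neg (ContourPath m))]
    rw [← Finset.sum_neg_distrib]
    exact Finset.sum_congr rfl fun a _ => hf a
  exact self_eq_neg.1 h

theorem siteWeight_ne_zero_of_treeWeight {γ β : ℕ → ℝ} {w : ℝ → ℂ} {D m : ℕ} {a : ContourPath m}
    (h : treeWeight γ β w D m a ≠ 0) : siteWeight β m a ≠ 0 := by
  cases m with
  | zero => exact h
  | succ m => exact left_ne_zero_of_mul h

/-- Consistency between depths: unitarity removes the last layer at the root, after which the last
layer of the subtrees is invisible to the action and is removed by induction. It yields the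
normalization `sum_treeWeight`. -/
theorem sum_treeWeight_truncPath_eq (γ β : ℕ → ℝ) (w : ℝ → ℂ) (hw : w 0 = 1) (D m : ℕ)
    (b : ContourPath m) :
    ∑ a : ContourPath (m + 1), (if truncPath a = b then treeWeight γ β w D (m + 1) a else 0) =
      treeWeight γ β w D m b := by
  have h1 : ∑ a : ContourPath (m + 1),
      (if truncPath a = b then treeWeight γ β w D (m + 1) a else 0) =
      siteWeight β m b * (∑ c, treeWeight γ β w D m c * w (action γ m b c)) ^ D := by
    rw [← sum_siteWeight_truncPath_eq, Finset.sum_mul]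
    refine Finset.sum_congr rfl fun a _ => ?_
    split_ifs with h
    · rw [← h]; rfl
    · simp
  rw [h1]
  by_cases hb : siteWeight β m b = 0
  · by_cases h : treeWeight γ β w D m b = 0
    · rw [hb, h, zero_mul]
    · exact absurd hb (siteWeight_ne_zero_of_treeWeight h)
  have hb' := siteWeight_ne_zero hb
  induction m with
  | zero =>
    have : ∀ c, treeWeight γ β w D 0 c * w (action γ 0 b c) = siteWeight β 0 c := by
      intro c
      by_cases hc : siteWeight β 0 c = 0
      · simp [treeWeight, hc]
      · rw [action_zero_layers γ hb' (siteWeight_ne_zero hc), hw, mul_one]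
        rfl
    simp only [this, sum_siteWeight, one_pow, mul_one]
    rfl
  | succ m ih =>
    have h2 : ∀ c', ∑ a : ContourPath (m + 1),
        (if truncPath a = c' then treeWeight γ β w D (m + 1) a else 0) =
        treeWeight γ β w D m c' := by
      intro c'
      have h1 : ∑ a : ContourPath (m + 1),
          (if truncPath a = c' then treeWeight γ β w D (m + 1) a else 0) =
          siteWeight β m c' * (∑ c, treeWeight γ β w D m c * w (action γ m c' c)) ^ D := by
        rw [← sum_siteWeight_truncPath_eq, Finset.sum_mul]
        refine Finset.sum_congr rfl fun a _ => ?_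
        split_ifs with h
        · rw [← h]; rfl
        · simp
      -- The induction hypothesis requires a nonzero site weight; otherwise both sides vanish.
      by_cases hc : siteWeight β m c' = 0
      · rw [h1, hc, zero_mul]
        by_contra h
        exact siteWeight_ne_zero_of_treeWeight (Ne.symm h) hc
      · rw [h1]
        exact ih c' h1 hc (siteWeight_ne_zero hc)
    change _ = siteWeight β (m + 1) b *
      (∑ c', treeWeight γ β w D m c' * w (action γ m (truncPath b) c')) ^ D
    congr 2
    simp only [← h2, Finset.sum_mul]
    rw [Finset.sum_comm]
    refine Finset.sum_congr rfl fun c _ => ?_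
    rw [Finset.sum_eq_single (truncPath c) (fun c' _ h => by rw [if_neg h.symm, zero_mul])
      (by simp), if_pos rfl]
    by_cases hc : treeWeight γ β w D (m + 1) c = 0
    · rw [hc, zero_mul, zero_mul]
    · rw [action_succ γ hb' (siteWeight_ne_zero (siteWeight_ne_zero_of_treeWeight hc))]

theorem sum_treeWeight (γ β : ℕ → ℝ) (w : ℝ → ℂ) (hw : w 0 = 1) (D m : ℕ) :
    ∑ a, treeWeight γ β w D m a = 1 := by
  induction m with
  | zero => exact sum_siteWeight β 0
  | succ m ih =>
    rw [← ih, Finset.sum_congr rfl fun b _ => (sum_treeWeight_truncPath_eq γ β w hw D m b).symm,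
      Finset.sum_comm]
    simp

/-- The limit of `treeWeight` for large degree. -/
def limitWeight (γ β : ℕ → ℝ) : (m : ℕ) → ContourPath m → ℂ
  | 0, a => siteWeight β 0 a
  | m + 1, a => siteWeight β (m + 1) a * Complex.exp
      (∑ b, limitWeight γ β m b * -((action γ m (truncPath a) b : ℂ) ^ 2 / 2))

/-- The phase factor of an edge for the MaxCut driver. -/
def driverPhase (D : ℕ) (x : ℝ) : ℂ :=
  Complex.exp (-(Complex.I * ((-(1 / Real.sqrt D) * x : ℝ) : ℂ)))

theorem driverPhase_zero (D : ℕ) : driverPhase D 0 = 1 := by simp [driverPhase]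

theorem tendsto_div_sqrt_nat (x : ℝ) : Tendsto (fun n : ℕ => x / Real.sqrt n) atTop (𝓝 0) :=
  Tendsto.div_atTop tendsto_const_nhds (Real.tendsto_sqrt_atTop.comp tendsto_natCast_atTop_atTop)

theorem tendsto_mul_exp_sub_one_sub (x : ℝ) :
    Tendsto (fun n : ℕ => (n : ℂ) * (Complex.exp (Complex.I * ((x / Real.sqrt n : ℝ) : ℂ)) - 1 -
      Complex.I * ((x / Real.sqrt n : ℝ) : ℂ))) atTop (𝓝 (-((x : ℂ) ^ 2 / 2))) := by
  rw [tendsto_iff_norm_sub_tendsto_zero]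
  have h1 : Tendsto (fun n : ℕ => x ^ 2 * |x / Real.sqrt n| * Real.exp |x / Real.sqrt n|) atTop
      (𝓝 0) := by
    have h := (tendsto_div_sqrt_nat x).abs
    rw [abs_zero] at h
    have h' := (Real.continuous_exp.tendsto 0).comp h
    have := (h.const_mul (x ^ 2)).mul h'
    simpa using this
  refine squeeze_zero' (Eventually.of_forall fun _ => norm_nonneg _) ?_ h1
  filter_upwards [eventually_gt_atTop 0] with n hn
  have hn' : (0 : ℝ) < n := by exact_mod_cast hn
  set y : ℝ := x / Real.sqrt n with hy
  have hy2 : (n : ℝ) * y ^ 2 = x ^ 2 := by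
    rw [hy, div_pow, Real.sq_sqrt hn'.le]
    field_simp
  have hy2' : (n : ℂ) * (y : ℂ) ^ 2 = (x : ℂ) ^ 2 := by exact_mod_cast hy2
  -- The third-order remainder is at most |y|³ exp |y|; multiplied by n it is x² |y| exp |y|, since
  -- n y² = x².
  have h2 := Complex.norm_exp_sub_sum_le_norm_mul_exp (Complex.I * (y : ℂ)) 3
  simp only [Finset.sum_range_succ, Finset.sum_range_zero, norm_mul, Complex.norm_I, one_mul,
    Complex.norm_real, Real.norm_eq_abs] at h2
  have h3 : (n : ℂ) * (Complex.exp (Complex.I * y) - 1 - Complex.I * y) - -((x : ℂ) ^ 2 / 2) =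
      n * (Complex.exp (Complex.I * y) - (0 + (Complex.I * y) ^ 0 / (Nat.factorial 0 : ℂ) +
        (Complex.I * y) ^ 1 / (Nat.factorial 1 : ℂ) +
        (Complex.I * y) ^ 2 / (Nat.factorial 2 : ℂ))) := by
    rw [← hy2']
    simp only [Nat.factorial, mul_pow, Complex.I_sq]
    push_cast
    ring
  rw [h3, norm_mul, Complex.norm_natCast]
  refine (mul_le_mul_of_nonneg_left h2 hn'.le).trans (le_of_eq ?_)
  rw [← hy2, ← sq_abs y]
  ring

theorem tendsto_sqrt_mul_exp_sub_one (x : ℝ) :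
    Tendsto (fun n : ℕ => (Real.sqrt n : ℂ) *
      (Complex.exp (Complex.I * ((x / Real.sqrt n : ℝ) : ℂ)) - 1)) atTop (𝓝 (Complex.I * x)) := by
  have h1 := tendsto_mul_exp_sub_one_sub x
  have h2 : Tendsto (fun n : ℕ => ((1 / Real.sqrt n : ℝ) : ℂ)) atTop (𝓝 0) := by
    have := (Complex.continuous_ofReal.tendsto 0).comp (tendsto_div_sqrt_nat 1)
    simpa [Function.comp_def] using this
  have h3 := (h2.mul h1).add_const (Complex.I * x)
  rw [zero_mul, zero_add] at h3
  refine h3.congr' ?_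
  filter_upwards [eventually_gt_atTop 0] with n hn
  have hn' : (0 : ℝ) < Real.sqrt n := Real.sqrt_pos.2 (by exact_mod_cast hn)
  have h0 : (Real.sqrt n : ℂ) ≠ 0 := by exact_mod_cast hn'.ne'
  have h4 : (n : ℂ) = (Real.sqrt n : ℂ) * (Real.sqrt n : ℂ) := by
    rw [← Complex.ofReal_mul, Real.mul_self_sqrt (Nat.cast_nonneg n)]
    simp
  rw [h4]
  push_cast
  field_simp
  ring

theorem driverPhase_eq (D : ℕ) (x : ℝ) :
    driverPhase D x = Complex.exp (Complex.I * ((x / Real.sqrt D : ℝ) : ℂ)) := by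
  rw [driverPhase]
  congr 1
  push_cast
  ring

/-- Expand the phase in 1/√D: the zeroth order sums to one by normalization, the first vanishes by
the flip symmetry, and the second survives multiplication by D and is exponentiated by the D-th
power. -/
theorem tendsto_treeWeight (γ β : ℕ → ℝ) (m : ℕ) (a : ContourPath m) :
    Tendsto (fun D : ℕ => treeWeight γ β (driverPhase D) D m a) atTop
      (𝓝 (limitWeight γ β m a)) := by
  induction m with
  | zero => exact tendsto_const_nhds
  | succ m ih =>
    simp only [treeWeight, limitWeight]
    refine Tendsto.const_mul _ ?_
    set a' := truncPath a
    have h1 : Tendsto (fun D : ℕ => (D : ℂ) * (∑ b, treeWeight γ β (driverPhase D) D m b *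
        driverPhase D (action γ m a' b) - 1)) atTop
        (𝓝 (∑ b, limitWeight γ β m b * -((action γ m a' b : ℂ) ^ 2 / 2))) := by
      have h2 : Tendsto (fun D : ℕ => ∑ b, treeWeight γ β (driverPhase D) D m b *
          ((D : ℂ) * (Complex.exp (Complex.I * ((action γ m a' b / Real.sqrt D : ℝ) : ℂ)) - 1 -
            Complex.I * ((action γ m a' b / Real.sqrt D : ℝ) : ℂ)))) atTop
          (𝓝 (∑ b, limitWeight γ β m b * -((action γ m a' b : ℂ) ^ 2 / 2))) :=
        tendsto_finsetSum _ fun b _ => (ih b).mul (tendsto_mul_exp_sub_one_sub _)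
      refine h2.congr fun D => ?_
      have h3 : ∑ b, treeWeight γ β (driverPhase D) D m b * (action γ m a' b : ℂ) = 0 := by
        refine sum_eq_zero_of_odd _ fun b => ?_
        rw [treeWeight_neg, action_neg_right]
        push_cast
        ring
      have h4 := sum_treeWeight γ β (driverPhase D) (driverPhase_zero D) D m
      have h5 : ∀ b, treeWeight γ β (driverPhase D) D m b *
          ((D : ℂ) * (Complex.exp (Complex.I * ((action γ m a' b / Real.sqrt D : ℝ) : ℂ)) - 1 -
            Complex.I * ((action γ m a' b / Real.sqrt D : ℝ) : ℂ))) =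
          D * (treeWeight γ β (driverPhase D) D m b * driverPhase D (action γ m a' b)) -
          D * treeWeight γ β (driverPhase D) D m b - D * Complex.I * (Real.sqrt D : ℂ)⁻¹ *
            (treeWeight γ β (driverPhase D) D m b * (action γ m a' b : ℂ)) := by
        intro b
        rw [driverPhase_eq]
        push_cast
        ring
      simp only [h5, Finset.sum_sub_distrib, ← Finset.mul_sum, h3, h4]
      ring
    have h6 := Complex.tendsto_one_add_pow_exp_of_tendsto h1
    simpa using h6

/-- The correlation of the two ends of an edge in a regular graph of large girth. -/
def edgeCorrelation (γ β : ℕ → ℝ) (D p : ℕ) : ℂ :=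
  ∑ a : ContourPath p, ∑ b : ContourPath p,
    treeWeight γ β (driverPhase D) D p a * treeWeight γ β (driverPhase D) D p b *
      ((signVal (a.1 (Fin.last p)) : ℂ) * signVal (b.1 (Fin.last p))) *
      driverPhase D (action γ p a b)

/-- The limit of `√D` times `edgeCorrelation`. -/
def limitCorrelation (γ β : ℕ → ℝ) (p : ℕ) : ℂ :=
  ∑ a : ContourPath p, ∑ b : ContourPath p,
    limitWeight γ β p a * limitWeight γ β p b *
      ((signVal (a.1 (Fin.last p)) : ℂ) * signVal (b.1 (Fin.last p))) *
      (Complex.I * action γ p a b)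

/-- The final sign has weighted sum zero by the flip symmetry, so 1 may be subtracted from the phase
of the edge; √D times the rest converges. -/
theorem tendsto_edgeCorrelation (γ β : ℕ → ℝ) (p : ℕ) :
    Tendsto (fun D : ℕ => (Real.sqrt D : ℂ) * edgeCorrelation γ β D p) atTop
      (𝓝 (limitCorrelation γ β p)) := by
  have h1 : Tendsto (fun D : ℕ => ∑ a : ContourPath p, ∑ b : ContourPath p,
      treeWeight γ β (driverPhase D) D p a * treeWeight γ β (driverPhase D) D p b *
      ((signVal (a.1 (Fin.last p)) : ℂ) * signVal (b.1 (Fin.last p))) *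
      ((Real.sqrt D : ℂ) *
      (Complex.exp (Complex.I * ((action γ p a b / Real.sqrt D : ℝ) : ℂ)) - 1))) atTop
      (𝓝 (limitCorrelation γ β p)) :=
    tendsto_finsetSum _ fun a _ => tendsto_finsetSum _ fun b _ =>
      (((tendsto_treeWeight γ β p a).mul (tendsto_treeWeight γ β p b)).mul_const _).mul
        (tendsto_sqrt_mul_exp_sub_one _)
  refine h1.congr fun D => ?_
  have h2 : ∑ b, treeWeight γ β (driverPhase D) D p b * (signVal (b.1 (Fin.last p)) : ℂ) = 0 := by
    refine sum_eq_zero_of_odd _ fun b => ?_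
    rw [treeWeight_neg, Prod.fst_neg, Pi.neg_apply, signVal_neg]
    push_cast
    ring
  have h3 : ∀ a b : ContourPath p,
      treeWeight γ β (driverPhase D) D p a * treeWeight γ β (driverPhase D) D p b *
      ((signVal (a.1 (Fin.last p)) : ℂ) * signVal (b.1 (Fin.last p))) *
      ((Real.sqrt D : ℂ) *
      (Complex.exp (Complex.I * ((action γ p a b / Real.sqrt D : ℝ) : ℂ)) - 1)) =
      (Real.sqrt D : ℂ) * (treeWeight γ β (driverPhase D) D p a *
        treeWeight γ β (driverPhase D) D p b *
        ((signVal (a.1 (Fin.last p)) : ℂ) * signVal (b.1 (Fin.last p))) *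
        driverPhase D (action γ p a b)) -
      (Real.sqrt D : ℂ) * (treeWeight γ β (driverPhase D) D p a * signVal (a.1 (Fin.last p))) *
        (treeWeight γ β (driverPhase D) D p b * signVal (b.1 (Fin.last p))) := by
    intro a b
    rw [driverPhase_eq]
    ring
  simp only [h3, Finset.sum_sub_distrib, ← Finset.mul_sum, h2, mul_zero,
    sub_zero, edgeCorrelation]

end

noncomputable section

/-! ### Averaging over the couplings -/

/-- The average of the phase factor of a random coupling. -/
def charPhase (μ : Measure ℝ) (x : ℝ) : ℂ :=
  ∫ y, Complex.exp (-(Complex.I * ((y * x : ℝ) : ℂ))) ∂μ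

/-- The average of a random coupling times its phase factor. -/
def couplingPhase (μ : Measure ℝ) (x : ℝ) : ℂ :=
  ∫ y, (y : ℂ) * Complex.exp (-(Complex.I * ((y * x : ℝ) : ℂ))) ∂μ

theorem norm_exp_neg_I_mul_ofReal (x : ℝ) : ‖Complex.exp (-(Complex.I * (x : ℂ)))‖ = 1 := by
  have : -(Complex.I * (x : ℂ)) = ((-x : ℝ) : ℂ) * Complex.I := by push_cast; ring
  rw [this, Complex.norm_exp_ofReal_mul_I]

/-! ### Small-argument asymptotics of the averaged phases. -/

section Moments

variable (μ : Measure ℝ) [IsProbabilityMeasure μ]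

theorem integrable_exp_neg_I_mul (x : ℝ) :
    Integrable (fun y : ℝ => Complex.exp (-(Complex.I * ((y * x : ℝ) : ℂ)))) μ := by
  refine Integrable.of_bound (C := 1) (by fun_prop) (Eventually.of_forall fun y => ?_)
  rw [norm_exp_neg_I_mul_ofReal]

variable {μ}

theorem integrable_mul_exp_neg_I_mul (hμ : MemLp (fun x : ℝ => x) 2 μ) (x : ℝ) :
    Integrable (fun y : ℝ => (y : ℂ) * Complex.exp (-(Complex.I * ((y * x : ℝ) : ℂ)))) μ := by
  have h : Integrable (fun y : ℝ => (y : ℂ)) μ := (hμ.integrable (by norm_num)).ofReal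
  refine h.mul_bdd (c := 1) (by fun_prop) (Eventually.of_forall fun y => ?_)
  rw [norm_exp_neg_I_mul_ofReal]

theorem charPhase_zero : charPhase μ 0 = 1 := by simp [charPhase]

theorem couplingPhase_zero {μ : Measure ℝ} (h0 : ∫ x, x ∂μ = 0) : couplingPhase μ 0 = 0 := by
  simp only [couplingPhase, mul_zero, Complex.ofReal_zero, neg_zero, Complex.exp_zero, mul_one]
  rw [integral_complex_ofReal, h0, Complex.ofReal_zero]

theorem tendsto_mul_one_sub_charPhase (h0 : ∫ x, x ∂μ = 0) (h1 : ∫ x, x ^ 2 ∂μ = 1) (x : ℝ) :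
    Tendsto (fun n : ℕ => (n : ℂ) * (1 - charPhase μ (x / Real.sqrt n))) atTop
      (𝓝 ((x : ℂ) ^ 2 / 2)) := by
  have h2 := taylor_charFun_two (P := μ) (X := id) aemeasurable_id (by simpa using h0)
    (by simpa [Pi.pow_def] using h1)
  rw [Measure.map_id] at h2
  have ht : Tendsto (fun n : ℕ => -(x / Real.sqrt n)) atTop (𝓝 0) := by
    simpa using (tendsto_div_sqrt_nat x).neg
  have h3 := h2.comp_tendsto ht
  have h4 : Tendsto (fun n : ℕ => (n : ℂ) * (charPhase μ (x / Real.sqrt n) -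
      (1 - ((x / Real.sqrt n : ℝ) : ℂ) ^ 2 / 2))) atTop (𝓝 0) := by
    rw [Metric.tendsto_nhds]
    intro ε hε
    -- The denominator x² + 1 makes the final bound strictly below ε, also for x = 0.
    have hc : 0 < ε / (x ^ 2 + 1) := by positivity
    filter_upwards [h3.def hc, eventually_gt_atTop 0] with n hn hpos
    have hn' : (0 : ℝ) < n := by exact_mod_cast hpos
    have h5 : charPhase μ (x / Real.sqrt n) = charFun μ (-(x / Real.sqrt n)) := by
      rw [charFun_apply_real, charPhase]
      refine integral_congr_ae (Eventually.of_forall fun y => ?_)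
      simp only
      congr 1
      push_cast
      ring
    have h6 : ‖(-(x / Real.sqrt n)) ^ 2‖ = x ^ 2 / n := by
      rw [neg_sq, div_pow, Real.sq_sqrt hn'.le, Real.norm_of_nonneg (by positivity)]
    simp only [Function.comp] at hn
    rw [h6] at hn
    rw [dist_zero_right, norm_mul, Complex.norm_natCast, h5]
    have h7 : ((x / Real.sqrt n : ℝ) : ℂ) ^ 2 = ((-(x / Real.sqrt n) : ℝ) : ℂ) ^ 2 := by
      push_cast; ring
    rw [h7]
    calc (n : ℝ) * _ ≤ n * (ε / (x ^ 2 + 1) * (x ^ 2 / n)) := by gcongr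
      _ = ε * (x ^ 2 / (x ^ 2 + 1)) := by field_simp
      _ < ε * 1 := by
        gcongr
        rw [div_lt_one (by positivity)]
        linarith
      _ = ε := mul_one ε
  have h8 := h4.const_sub ((x : ℂ) ^ 2 / 2)
  rw [sub_zero] at h8
  refine h8.congr' ?_
  filter_upwards [eventually_gt_atTop 0] with n hn
  have hn' : (0 : ℝ) < n := by exact_mod_cast hn
  have : (n : ℂ) * ((x / Real.sqrt n : ℝ) : ℂ) ^ 2 = (x : ℂ) ^ 2 := by
    have : (n : ℝ) * (x / Real.sqrt n) ^ 2 = x ^ 2 := by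
      rw [div_pow, Real.sq_sqrt hn'.le]
      field_simp
    exact_mod_cast this
  linear_combination (-1 / 2 : ℂ) * this

/-- Mean zero allows subtracting 1 from the phase. The integrand then tends to -ixy² and is
dominated by |x| y², which is integrable by the second moment. -/
theorem tendsto_sqrt_mul_couplingPhase (hμ : MemLp (fun x : ℝ => x) 2 μ) (h0 : ∫ x, x ∂μ = 0)
    (h1 : ∫ x, x ^ 2 ∂μ = 1) (x : ℝ) :
    Tendsto (fun n : ℕ => (Real.sqrt n : ℂ) * couplingPhase μ (x / Real.sqrt n)) atTop
      (𝓝 (-(Complex.I * x))) := by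
  have hlim : ∫ y : ℝ, (y : ℂ) * (Complex.I * ((-(y * x) : ℝ) : ℂ)) ∂μ = -(Complex.I * x) := by
    have : ∀ y : ℝ, (y : ℂ) * (Complex.I * ((-(y * x) : ℝ) : ℂ)) =
        -(Complex.I * x) * ((y ^ 2 : ℝ) : ℂ) := by
      intro y; push_cast; ring
    simp only [this]
    rw [integral_const_mul, integral_complex_ofReal, h1]
    simp
  have h2 : ∀ n : ℕ, (Real.sqrt n : ℂ) * couplingPhase μ (x / Real.sqrt n) =
      ∫ y : ℝ, (y : ℂ) * ((Real.sqrt n : ℂ) *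
        (Complex.exp (Complex.I * ((-(y * x) / Real.sqrt n : ℝ) : ℂ)) - 1)) ∂μ := by
    intro n
    have h3 : ∫ y : ℝ, (y : ℂ) ∂μ = 0 := by rw [integral_complex_ofReal, h0, Complex.ofReal_zero]
    have h4 : Integrable (fun y : ℝ => (y : ℂ)) μ := (hμ.integrable (by norm_num)).ofReal
    have h5 : couplingPhase μ (x / Real.sqrt n) = couplingPhase μ (x / Real.sqrt n) -
      ∫ y : ℝ, (y : ℂ) ∂μ := by rw [h3, sub_zero]
    rw [h5, couplingPhase, ← integral_sub (integrable_mul_exp_neg_I_mul hμ _) h4,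
      ← integral_const_mul]
    refine integral_congr_ae (Eventually.of_forall fun y => ?_)
    simp only
    have : -(Complex.I * ((y * (x / Real.sqrt n) : ℝ) : ℂ)) =
        Complex.I * ((-(y * x) / Real.sqrt n : ℝ) : ℂ) := by
      push_cast; ring
    rw [this]
    ring
  simp only [h2]
  rw [← hlim]
  have hsq : Integrable (fun y : ℝ => y ^ 2 * |x|) μ := (hμ.integrable_sq).mul_const _
  refine tendsto_integral_of_dominated_convergence _ (fun n => by fun_prop) hsq ?_ ?_
  · intro n
    refine Eventually.of_forall fun y => ?_
    rw [norm_mul, norm_mul, Complex.norm_real, Complex.norm_real, Real.norm_eq_abs,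
      Real.norm_eq_abs, abs_of_nonneg (Real.sqrt_nonneg _)]
    have h6 := Real.norm_exp_I_mul_ofReal_sub_one_le (x := -(y * x) / Real.sqrt n)
    rw [Real.norm_eq_abs, abs_div, abs_neg, abs_of_nonneg (Real.sqrt_nonneg _), abs_mul] at h6
    have h7 : Real.sqrt n * (|y| * |x| / Real.sqrt n) ≤ |y| * |x| := by
      rcases eq_or_ne (Real.sqrt n) 0 with h | h
      · rw [h, zero_mul]; positivity
      · rw [mul_div_cancel₀ _ h]
    calc |y| * (Real.sqrt n * _) ≤ |y| * (Real.sqrt n * (|y| * |x| / Real.sqrt n)) := by gcongr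
      _ ≤ |y| * (|y| * |x|) := by gcongr
      _ = y ^ 2 * |x| := by rw [← sq_abs y]; ring
  · exact Eventually.of_forall fun y => (tendsto_sqrt_mul_exp_sub_one _).const_mul _

end Moments

/-- The pairs of qubits of the Sherrington–Kirkpatrick model. -/
abbrev skEdges (n : ℕ) : Finset (Sym2 (Fin n)) := (⊤ : SimpleGraph (Fin n)).edgeFinset

theorem pairs_mk_injective (n : ℕ) :
    Function.Injective fun ij : Pairs n => s(ij.1.1, ij.1.2) := by
  rintro ⟨⟨i, j⟩, h⟩ ⟨⟨i', j'⟩, h'⟩ heq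
  simp only at heq h h'
  rcases Sym2.eq_iff.1 heq with ⟨rfl, rfl⟩ | ⟨rfl, rfl⟩
  · rfl
  · exact absurd (h.trans h') (lt_irrefl _)

theorem image_pairs_mk (n : ℕ) :
    Finset.univ.image (fun ij : Pairs n => s(ij.1.1, ij.1.2)) = skEdges n := by
  ext e
  induction e using Sym2.ind with
  | _ i j =>
    simp only [Finset.mem_image, Finset.mem_univ, true_and, SimpleGraph.mem_edgeFinset,
      SimpleGraph.mem_edgeSet, SimpleGraph.top_adj]
    constructor
    · rintro ⟨⟨⟨a, b⟩, hab⟩, h⟩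
      simp only at h hab
      rcases Sym2.eq_iff.1 h with ⟨rfl, rfl⟩ | ⟨rfl, rfl⟩
      · exact hab.ne
      · exact hab.ne'
    · intro hij
      rcases lt_or_gt_of_ne hij with h | h
      · exact ⟨⟨(i, j), h⟩, rfl⟩
      · exact ⟨⟨(j, i), h⟩, Sym2.eq_swap⟩

/-- The coupling of an unordered pair of qubits. -/
def couplingOf {n : ℕ} (J : Pairs n → ℝ) (e : Sym2 (Fin n)) : ℝ :=
  Function.extend (fun ij : Pairs n => s(ij.1.1, ij.1.2)) J 0 e

@[simp] theorem couplingOf_mk {n : ℕ} (J : Pairs n → ℝ) (ij : Pairs n) :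
    couplingOf J s(ij.1.1, ij.1.2) = J ij :=
  (pairs_mk_injective n).extend_apply J 0 ij

/-- Trivial factors on the missing pairs bring the product into the form to which the product
measure applies. -/
theorem prod_eq_prod_pairs {n : ℕ} {M : Type*} [CommMonoid M] {E : Finset (Sym2 (Fin n))}
    (hE : E ⊆ skEdges n) (g : Sym2 (Fin n) → M) :
    ∏ e ∈ E, g e = ∏ ij : Pairs n, if s(ij.1.1, ij.1.2) ∈ E then g s(ij.1.1, ij.1.2) else 1 := by
  have h1 : ∏ e ∈ E, g e = ∏ e ∈ skEdges n, if e ∈ E then g e else 1 := by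
    rw [Finset.prod_ite_mem, Finset.inter_eq_right.2 hE]
  rw [h1, ← image_pairs_mk, Finset.prod_image fun _ _ _ _ h => pairs_mk_injective n h]

theorem skCost_eq (n : ℕ) (J : Pairs n → ℝ) (z : Fin n → ℤˣ) :
    skCost n J z = ∑ e ∈ skEdges n, (couplingOf J e / Real.sqrt n) * edgeProd z e := by
  rw [skCost, ← image_pairs_mk, Finset.sum_image fun _ _ _ _ h => pairs_mk_injective n h,
    Finset.mul_sum]
  refine Finset.sum_congr rfl fun ij _ => ?_
  rw [couplingOf_mk]
  simp only [edgeProd, Sym2.lift_mk]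
  ring

/-- Averages over independent couplings act on each pair of qubits separately. -/
theorem integral_contourSum (μ : Measure ℝ) [IsProbabilityMeasure μ] (γ β : ℕ → ℝ) {n : ℕ}
    {E : Finset (Sym2 (Fin n))} (hE : E ⊆ skEdges n) (h : Sym2 (Fin n) → ℝ → ℝ → ℂ)
    (hint : ∀ e x, Integrable (fun y => h e y x) μ) (m : ℕ) (F : (Fin n → ContourPath m) → ℂ) :
    Integrable (fun J : Pairs n → ℝ =>
      contourSum γ β E (fun e x => h e (couplingOf J e) x) m F) (couplingLaw μ n) ∧
    ∫ J, contourSum γ β E (fun e x => h e (couplingOf J e) x) m F ∂(couplingLaw μ n) =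
      contourSum γ β E (fun e x => ∫ y, h e y x ∂μ) m F := by
  have h1 : ∀ (J : Pairs n → ℝ) (c : Fin n → ContourPath m),
      ∏ e ∈ E, h e (couplingOf J e) (pairAction γ m c e) = ∏ ij : Pairs n,
        (fun (ij : Pairs n) (y : ℝ) => if s(ij.1.1, ij.1.2) ∈ E then
          h s(ij.1.1, ij.1.2) y (pairAction γ m c s(ij.1.1, ij.1.2)) else 1) ij (J ij) := by
    intro J c
    rw [prod_eq_prod_pairs hE]
    simp only [couplingOf_mk]
  have h2 : ∀ (c : Fin n → ContourPath m) (ij : Pairs n),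
      Integrable (fun y : ℝ => if s(ij.1.1, ij.1.2) ∈ E then
          h s(ij.1.1, ij.1.2) y (pairAction γ m c s(ij.1.1, ij.1.2)) else 1) μ := by
    intro c ij
    split_ifs
    · exact hint _ _
    · exact integrable_const _
  have h3 : ∀ c : Fin n → ContourPath m, Integrable (fun J : Pairs n → ℝ =>
      (∏ v, siteWeight β m (c v)) * (∏ e ∈ E, h e (couplingOf J e) (pairAction γ m c e)) * F c)
      (couplingLaw μ n) := by
    intro c
    simp only [h1]
    exact ((Integrable.fintype_prod (μ := fun _ : Pairs n => μ) (h2 c)).const_mul _).mul_const _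
  refine ⟨integrable_finsetSum _ fun c _ => h3 c, ?_⟩
  simp only [contourSum]
  rw [integral_finsetSum _ fun c _ => h3 c]
  refine Finset.sum_congr rfl fun c _ => ?_
  rw [integral_mul_const, integral_const_mul]
  congr 2
  simp only [fun J => h1 J c]
  rw [couplingLaw, prod_eq_prod_pairs hE]
  refine (integral_fintype_prod_eq_prod (μ := fun _ : Pairs n => μ) (fun ij y =>
    if s(ij.1.1, ij.1.2) ∈ E then
      h s(ij.1.1, ij.1.2) y (pairAction γ m c s(ij.1.1, ij.1.2)) else 1)).trans ?_
  refine Finset.prod_congr rfl fun ij _ => ?_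
  split_ifs <;> simp

/-- The phase weights of the Sherrington–Kirkpatrick model, averaged over the couplings. -/
def skPhase (μ : Measure ℝ) (n : ℕ) (x : ℝ) : ℂ := charPhase μ (x / Real.sqrt n)

/-- The averaged sum is the mean over J of sums bounded by unitarity. The bound is uniform in n and
in the size of `U`, as the subset expansion requires. -/
theorem norm_contourSum_skPhase_le_one (μ : Measure ℝ) [IsProbabilityMeasure μ] (γ β : ℕ → ℝ)
    {n : ℕ} {E : Finset (Sym2 (Fin n))} (hE : E ⊆ skEdges n) (U : Finset (Fin n)) (m : ℕ)
    (a : Fin n → ContourPath m) :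
    ‖contourSum γ β E (fun _ => skPhase μ n) m
      (pathIndicator U a)‖ ≤ 1 := by
  have h1 := (integral_contourSum μ γ β hE
    (fun _ y x => Complex.exp (-(Complex.I * ((y * (x / Real.sqrt n) : ℝ) : ℂ))))
    (fun _ x => integrable_exp_neg_I_mul μ _) m
    (pathIndicator U a)).2
  change _ = contourSum γ β E (fun _ => skPhase μ n) m _ at h1
  rw [← h1]
  have : IsProbabilityMeasure (couplingLaw μ n) := by unfold couplingLaw; infer_instance
  refine (norm_integral_le_of_norm_le_const (C := 1) (Eventually.of_forall fun J => ?_)).trans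
    (by simp)
  have h2 := norm_contourSum_indicator_le_one γ β E (fun e => couplingOf J e / Real.sqrt n) U m a
  have h3 : ∀ e x, couplingOf J e * (x / Real.sqrt n) = couplingOf J e / Real.sqrt n * x :=
    fun e x => by ring
  simp only [h3]
  exact h2

end

noncomputable section

/-! ### Asymptotic independence in the Sherrington–Kirkpatrick model -/

/-- In the averaged model with `K` qubits removed, the paths of any `k` qubits become independent. -/
def AsymptoticallyIndependent (μ : Measure ℝ) (γ β : ℕ → ℝ) (m : ℕ) : Prop :=
  ∀ K k : ℕ, ∃ ε : ℕ → ℝ, (∀ n, 0 ≤ ε n) ∧ Tendsto ε atTop (𝓝 0) ∧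
    ∀ n, 0 < n → ∀ A U : Finset (Fin n), A.card = K → U.card = k → (∀ u ∈ U, u ∉ A) →
      ∀ a : Fin n → ContourPath m,
        ‖contourSum γ β (edgesAvoiding ⊤ A) (fun _ => skPhase μ n) m (pathIndicator U a) -
          ∏ u ∈ U, limitWeight γ β m (a u)‖ ≤ ε n

theorem tendsto_of_tendsto_natCast_mul {f : ℕ → ℂ} {t : ℂ}
    (h : Tendsto (fun n : ℕ => (n : ℂ) * f n) atTop (𝓝 t)) : Tendsto f atTop (𝓝 0) := by
  have h1 : Tendsto (fun n : ℕ => ((n : ℂ))⁻¹) atTop (𝓝 0) := tendsto_inv_atTop_nhds_zero_nat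
  have h2 := h1.mul h
  rw [zero_mul] at h2
  refine h2.congr' ?_
  filter_upwards [eventually_gt_atTop 0] with n hn
  have : (n : ℂ) ≠ 0 := by exact_mod_cast hn.ne'
  field_simp

theorem tendsto_one_add_pow_sub {f : ℕ → ℂ} {t : ℂ} (K : ℕ)
    (h : Tendsto (fun n : ℕ => (n : ℂ) * f n) atTop (𝓝 t)) :
    Tendsto (fun n : ℕ => (1 + f n) ^ (n - K)) atTop (𝓝 (Complex.exp t)) := by
  rw [← tendsto_add_atTop_iff_nat K]
  simp only [Nat.add_sub_cancel]
  refine Complex.tendsto_one_add_pow_exp_of_tendsto ?_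
  have h1 := (tendsto_add_atTop_iff_nat K).2 h
  have h2 := (tendsto_add_atTop_iff_nat K).2 (tendsto_of_tendsto_natCast_mul h)
  have h3 := h1.sub (h2.const_mul (K : ℂ))
  rw [mul_zero, sub_zero] at h3
  refine h3.congr fun n => ?_
  push_cast
  ring

/-- Induction through 1 - qQ = (1 - q) + q(1 - Q), where q tends to 1. -/
theorem tendsto_natCast_mul_one_sub_prod {ι : Type*} (s : Finset ι) (q : ι → ℕ → ℂ) (t : ι → ℂ)
    (h : ∀ i ∈ s, Tendsto (fun n : ℕ => (n : ℂ) * (1 - q i n)) atTop (𝓝 (t i))) :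
    Tendsto (fun n : ℕ => (n : ℂ) * (1 - ∏ i ∈ s, q i n)) atTop (𝓝 (∑ i ∈ s, t i)) := by
  classical
  induction s using Finset.induction_on with
  | empty => simp
  | insert j s hj ih =>
    have h1 := h j (Finset.mem_insert_self j s)
    have h2 := ih fun i hi => h i (Finset.mem_insert_of_mem hi)
    have h3 : Tendsto (fun n => q j n) atTop (𝓝 1) := by
      have := (tendsto_of_tendsto_natCast_mul h1).const_sub 1
      simpa using this
    have h4 := h1.add (h3.mul h2)
    rw [Finset.sum_insert hj, ← one_mul (∑ i ∈ s, t i)]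
    refine h4.congr fun n => ?_
    rw [Finset.prod_insert hj]
    ring

/-- Given asymptotic independence, a product over all remaining qubits of factors close to one
converges. -/
theorem AsymptoticallyIndependent.contourSum_prod {μ : Measure ℝ} [IsProbabilityMeasure μ]
    {γ β : ℕ → ℝ} {m : ℕ} (h : AsymptoticallyIndependent μ γ β m) (K : ℕ)
    (g : ℕ → ContourPath m → ℂ) (s : ContourPath m → ℂ)
    (hg : ∀ b, Tendsto (fun n => g n b) atTop (𝓝 (s b))) :
    ∃ ε : ℕ → ℝ, (∀ n, 0 ≤ ε n) ∧ Tendsto ε atTop (𝓝 0) ∧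
      ∀ n, 0 < n → ∀ A : Finset (Fin n), A.card = K →
        ‖contourSum γ β (edgesAvoiding ⊤ A) (fun _ => skPhase μ n) m
            (fun c => ∏ x ∈ Aᶜ, (1 - g n (c x) / n)) -
          Complex.exp (∑ b, limitWeight γ β m b * -(s b))‖ ≤ ε n := by
  choose ε hε0 hε1 hε2 using h K
  set ρ := limitWeight γ β m with hρ
  set G : ℕ → ℝ := fun n => ∑ b, ‖g n b‖ with hG
  set B : ℝ := ∑ b, ‖ρ b‖ with hB
  have hG0 : ∀ n, 0 ≤ G n := fun n => Finset.sum_nonneg fun _ _ => norm_nonneg _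
  have hB0 : 0 ≤ B := Finset.sum_nonneg fun _ _ => norm_nonneg _
  have hGlim : Tendsto G atTop (𝓝 (∑ b, ‖s b‖)) := tendsto_finsetSum _ fun b _ => (hg b).norm
  obtain ⟨M, hM⟩ := hGlim.bddAbove_range
  have hGM : ∀ n, G n ≤ M := fun n => hM ⟨n, rfl⟩
  have hM0 : 0 ≤ M := (hG0 0).trans (hGM 0)
  -- Independence gives `ε r n`, which tends to zero for each r but not uniformly in r; unitarity
  -- gives `1 + B ^ r`, uniform in n. The minimum permits dominated convergence of the series over
  -- r.
  set δ : ℕ → ℕ → ℝ := fun n r => min (ε r n) (1 + B ^ r) with hδ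
  have hδ0 : ∀ n r, 0 ≤ δ n r := fun n r => le_min (hε0 r n) (by positivity)
  set T : ℕ → ℕ → ℝ := fun n r => G n ^ r / r.factorial * δ n r with hT
  have hT0 : ∀ n r, 0 ≤ T n r := fun n r => mul_nonneg (div_nonneg (pow_nonneg (hG0 n) r)
    (Nat.cast_nonneg _)) (hδ0 n r)
  set bd : ℕ → ℝ := fun r => M ^ r / r.factorial + (M * B) ^ r / r.factorial with hbd
  have hbdsum : Summable bd :=
    (Real.summable_pow_div_factorial M).add (Real.summable_pow_div_factorial (M * B))
  have hTbd : ∀ n r, T n r ≤ bd r := by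
    intro n r
    calc T n r ≤ M ^ r / r.factorial * (1 + B ^ r) := by
          refine mul_le_mul ?_ (min_le_right _ _) (hδ0 n r) (by positivity)
          exact div_le_div_of_nonneg_right (pow_le_pow_left₀ (hG0 n) (hGM n) r)
            (Nat.cast_nonneg _)
      _ = bd r := by simp only [hbd, mul_pow]; ring
  have hTsum : ∀ n, Summable (T n) := fun n =>
    Summable.of_nonneg_of_le (hT0 n) (hTbd n) hbdsum
  have hTlim : Tendsto (fun n => ∑' r, T n r) atTop (𝓝 0) := by
    have := tendsto_tsum_of_dominated_convergence (𝓕 := atTop) (f := T) (g := fun _ => (0 : ℝ)) hbdsum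
      (fun r => ?_) (Eventually.of_forall fun n r => ?_)
    · simpa using this
    · have h1 : Tendsto (fun n => δ n r) atTop (𝓝 0) :=
        squeeze_zero (fun n => hδ0 n r) (fun n => min_le_left _ _) (hε1 r)
      have h2 := ((hGlim.pow r).div_const (r.factorial : ℝ)).mul h1
      rw [mul_zero] at h2
      exact h2
    · rw [Real.norm_of_nonneg (hT0 n r)]
      exact hTbd n r
  set f : ℕ → ℂ := fun n => ∑ b, ρ b * -(g n b / n) with hf
  have hflim : Tendsto (fun n : ℕ => (n : ℂ) * f n) atTop (𝓝 (∑ b, ρ b * -(s b))) := by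
    have h1 : Tendsto (fun n : ℕ => ∑ b, ρ b * -(g n b)) atTop (𝓝 (∑ b, ρ b * -(s b))) :=
      tendsto_finsetSum _ fun b _ => (hg b).neg.const_mul _
    refine h1.congr' ?_
    filter_upwards [eventually_gt_atTop 0] with n hn
    have : (n : ℂ) ≠ 0 := by exact_mod_cast hn.ne'
    rw [hf, Finset.mul_sum]
    refine Finset.sum_congr rfl fun b _ => ?_
    field_simp
  have hpow := tendsto_one_add_pow_sub K hflim
  rw [tendsto_iff_norm_sub_tendsto_zero] at hpow
  refine ⟨fun n => (∑' r, T n r) +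
    ‖(1 + f n) ^ (n - K) - Complex.exp (∑ b, ρ b * -(s b))‖, fun n => ?_, ?_, ?_⟩
  · exact add_nonneg (tsum_nonneg (hT0 n)) (norm_nonneg _)
  · simpa using hTlim.add hpow
  intro n hn A hA
  have hn' : (0 : ℝ) < n := by exact_mod_cast hn
  set S : Finset (Fin n) := Aᶜ with hS
  have hScard : S.card = n - K := by rw [hS, Finset.card_compl, hA, Fintype.card_fin]
  set w : Sym2 (Fin n) → ℝ → ℂ := fun _ => skPhase μ n with hw
  set E := edgesAvoiding (⊤ : SimpleGraph (Fin n)) A with hE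
  -- Both sides are expanded over the subsets R of the remaining qubits and compared subset by
  -- subset.
  have h1 : contourSum γ β E w m (fun c => ∏ x ∈ S, (1 - g n (c x) / n)) =
      ∑ R ∈ S.powerset, contourSum γ β E w m (fun c => ∏ x ∈ R, -(g n (c x) / n)) := by
    rw [← contourSum_sum]
    congr 1
    funext c
    simp only [sub_eq_add_neg]
    exact Finset.prod_one_add S
  have h2 : (1 + f n) ^ (n - K) = ∑ R ∈ S.powerset, ∏ x ∈ R, f n := by
    rw [← Finset.prod_one_add, Finset.prod_const, hScard]
  have h3 : ∀ R ∈ S.powerset, ‖contourSum γ β E w m (fun c => ∏ x ∈ R, -(g n (c x) / n)) -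
      ∏ x ∈ R, f n‖ ≤ (G n / n) ^ R.card * δ n R.card := by
    intro R hR
    have hRA : ∀ u ∈ R, u ∉ A := fun u hu => Finset.mem_compl.1 (Finset.mem_powerset.1 hR hu)
    have h4 := norm_contourSum_prod_sub_le γ β E w m R ρ (δ n R.card) (fun a => ?_)
      (fun _ b => -(g n b / n))
    · refine h4.trans (le_of_eq ?_)
      rw [Finset.prod_const]
      congr 2
      rw [hG, Finset.sum_div]
      exact Finset.sum_congr rfl fun b _ => by rw [norm_neg, norm_div, Complex.norm_natCast]
    · refine le_min (hε2 R.card n hn A R hA rfl hRA a) ?_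
      refine (norm_sub_le _ _).trans (add_le_add
        (norm_contourSum_skPhase_le_one μ γ β (edgesAvoiding_subset _ A) R m a) ?_)
      rw [norm_prod]
      refine (Finset.prod_le_prod (fun _ _ => norm_nonneg _) (g := fun _ => B) fun u _ => ?_).trans
        (by rw [Finset.prod_const])
      exact Finset.single_le_sum (f := fun b => ‖ρ b‖) (fun _ _ => norm_nonneg _)
        (Finset.mem_univ (a u))
  have h5 : ‖contourSum γ β E w m (fun c => ∏ x ∈ S, (1 - g n (c x) / n)) - (1 + f n) ^ (n - K)‖ ≤
      ∑' r, T n r := by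
    rw [h1, h2, ← Finset.sum_sub_distrib]
    refine (norm_sum_le _ _).trans ((Finset.sum_le_sum h3).trans ?_)
    rw [Finset.sum_powerset_apply_card fun r => (G n / n) ^ r * δ n r]
    refine le_trans (Finset.sum_le_sum fun r _ => ?_)
      ((hTsum n).sum_le_tsum (Finset.range (S.card + 1)) fun r _ => hT0 n r)
    rw [nsmul_eq_mul, ← mul_assoc]
    refine mul_le_mul_of_nonneg_right ?_ (hδ0 n r)
    -- The number of r-subsets is compensated by the factor 1/n carried by each element.
    have h6 : ((S.card.choose r : ℕ) : ℝ) ≤ (n : ℝ) ^ r / r.factorial := by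
      refine (Nat.choose_le_pow_div r S.card).trans ?_
      gcongr
      rw [hScard]
      exact Nat.sub_le n K
    calc ((S.card.choose r : ℕ) : ℝ) * (G n / n) ^ r
        ≤ (n : ℝ) ^ r / r.factorial * (G n / n) ^ r := by
          exact mul_le_mul_of_nonneg_right h6 (pow_nonneg (div_nonneg (hG0 n) hn'.le) r)
      _ = G n ^ r / r.factorial := by rw [div_pow]; field_simp
  calc _ ≤ ‖contourSum γ β E w m (fun c => ∏ x ∈ S, (1 - g n (c x) / n)) - (1 + f n) ^ (n - K)‖ +
      ‖(1 + f n) ^ (n - K) - Complex.exp (∑ b, ρ b * -(s b))‖ := norm_sub_le_norm_sub_add_norm_sub ..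
    _ ≤ _ := add_le_add h5 le_rfl

/-- The frozen paths are recorded by a tuple over `Fin k`, of which there are finitely many
independently of n; this makes error bounds uniform in `U` and `a`. -/
theorem exists_prod_eq_prod_fin {ι T : Type*} (U : Finset ι) {k : ℕ} (hk : U.card = k) (a : ι → T) :
    ∃ α : Fin k → T, ∀ h : T → ℂ, ∏ u ∈ U, h (a u) = ∏ i, h (α i) := by
  refine ⟨fun i => a ((Finset.equivFinOfCardEq hk).symm i), fun h => ?_⟩
  rw [← Finset.prod_coe_sort, ← (Finset.equivFinOfCardEq hk).symm.prod_comp]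

section

variable {μ : Measure ℝ} [IsProbabilityMeasure μ]

theorem skPhase_zero (n : ℕ) : skPhase μ n 0 = 1 := by
  rw [skPhase, zero_div, charPhase_zero]

/-- The influence of `k` qubits with given paths on the other qubits. -/
theorem AsymptoticallyIndependent.contourSum_crossing {γ β : ℕ → ℝ} {m : ℕ}
    (h : AsymptoticallyIndependent μ γ β m) (h0 : ∫ x, x ∂μ = 0) (h1 : ∫ x, x ^ 2 ∂μ = 1)
    (K k : ℕ) (α : Fin k → ContourPath (m + 1)) :
    ∃ ε : ℕ → ℝ, (∀ n, 0 ≤ ε n) ∧ Tendsto ε atTop (𝓝 0) ∧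
      ∀ n, 0 < n → ∀ A U : Finset (Fin n), A.card = K → U.card = k → (∀ u ∈ U, u ∉ A) →
      ∀ a : Fin n → ContourPath (m + 1),
        (∀ h : ContourPath (m + 1) → ℂ, ∏ u ∈ U, h (a u) = ∏ i, h (α i)) →
        ‖contourSum γ β (edgesAvoiding ⊤ (A ∪ U)) (fun _ => skPhase μ n) m
            (fun c => ∏ u ∈ U, ∏ x with x ∉ U ∧ s(u, x) ∈ edgesAvoiding ⊤ A,
              skPhase μ n (action γ m (truncPath (a u)) (c x))) -
          ∏ i, Complex.exp (∑ b, limitWeight γ β m b *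
            -((action γ m (truncPath (α i)) b : ℂ) ^ 2 / 2))‖ ≤ ε n := by
  obtain ⟨ε, hε0, hε1, hε2⟩ := h.contourSum_prod (K + k)
    -- Chosen so that 1 - g/n is exactly the joint phase factor between one free qubit and all
    -- frozen ones.
    (fun n b => (n : ℂ) * (1 - ∏ i, skPhase μ n (action γ m (truncPath (α i)) b)))
    (fun b => ∑ i, (action γ m (truncPath (α i)) b : ℂ) ^ 2 / 2)
    (fun b => tendsto_natCast_mul_one_sub_prod _ _ _ fun i _ =>
      tendsto_mul_one_sub_charPhase h0 h1 _)
  refine ⟨ε, hε0, hε1, fun n hn A U hA hU hAU a ha => ?_⟩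
  have hn' : (n : ℂ) ≠ 0 := by exact_mod_cast hn.ne'
  have hcard : (A ∪ U).card = K + k := by
    rw [Finset.card_union_of_disjoint, hA, hU]
    exact Finset.disjoint_right.2 hAU
  have h2 := hε2 n hn (A ∪ U) hcard
  have h3 : ∀ b, 1 - (n : ℂ) * (1 - ∏ i, skPhase μ n (action γ m (truncPath (α i)) b)) / n =
      ∏ u ∈ U, skPhase μ n (action γ m (truncPath (a u)) b) := by
    intro b
    rw [ha fun a' => skPhase μ n (action γ m (truncPath a') b)]
    field_simp
    ring
  have h4 : ∏ i, Complex.exp (∑ b, limitWeight γ β m b *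
      -((action γ m (truncPath (α i)) b : ℂ) ^ 2 / 2)) = Complex.exp (∑ b, limitWeight γ β m b *
        -(∑ i, (action γ m (truncPath (α i)) b : ℂ) ^ 2 / 2)) := by
    rw [← Complex.exp_sum, Finset.sum_comm]
    congr 1
    refine Finset.sum_congr rfl fun b _ => ?_
    rw [← Finset.mul_sum, Finset.sum_neg_distrib]
  have h5 : ∀ u ∈ U, Finset.univ.filter (fun x => x ∉ U ∧ s(u, x) ∈
      edgesAvoiding (⊤ : SimpleGraph (Fin n)) A) = (A ∪ U)ᶜ := by
    intro u hu
    ext x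
    simp only [Finset.mem_filter, Finset.mem_univ, true_and, mk_mem_edgesAvoiding,
      SimpleGraph.top_adj, Finset.mem_compl, Finset.mem_union, not_or]
    constructor
    · tauto
    · rintro ⟨h6, h7⟩
      exact ⟨h7, fun h => h7 (h ▸ hu), hAU u hu, h6⟩
  rw [h4]
  simp only [h3] at h2
  have h6 : ∀ c : Fin n → ContourPath m, ∏ u ∈ U, ∏ x with x ∉ U ∧ s(u, x) ∈ edgesAvoiding ⊤ A,
      skPhase μ n (action γ m (truncPath (a u)) (c x)) =
      ∏ x ∈ (A ∪ U)ᶜ, ∏ u ∈ U, skPhase μ n (action γ m (truncPath (a u)) (c x)) := by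
    intro c
    rw [Finset.prod_comm]
    exact Finset.prod_congr rfl fun u hu => by rw [h5 u hu]
  simp only [h6]
  exact h2

theorem tendsto_skPhase (h0 : ∫ x, x ∂μ = 0) (h1 : ∫ x, x ^ 2 ∂μ = 1) (x : ℝ) :
    Tendsto (fun n => ‖skPhase μ n x - 1‖) atTop (𝓝 0) := by
  have h2 := tendsto_of_tendsto_natCast_mul (tendsto_mul_one_sub_charPhase h0 h1 x)
  rw [tendsto_zero_iff_norm_tendsto_zero] at h2
  exact h2.congr fun n => norm_sub_rev _ _

/-- Freeze the k qubits: the boundedly many pairs among them have phases tending to 1, and their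
influence on the rest tends to a product of exponentials, one per frozen qubit. This is the
recursion of `limitWeight`. -/
theorem asymptoticallyIndependent (h0 : ∫ x, x ∂μ = 0) (h1 : ∫ x, x ^ 2 ∂μ = 1) (γ β : ℕ → ℝ)
    (m : ℕ) : AsymptoticallyIndependent μ γ β m := by
  induction m with
  | zero =>
    intro K k
    refine ⟨fun _ => 0, fun _ => le_rfl, tendsto_const_nhds, fun n _ A U _ _ _ a => ?_⟩
    rw [contourSum_zero_indicator]
    simp [skPhase_zero, limitWeight]
  | succ m ih =>
    intro K k
    choose ε hε0 hε1 hε2 using ih.contourSum_crossing h0 h1 K k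
    set X : (Fin k → ContourPath (m + 1)) → ℂ := fun α => ∏ i, Complex.exp
      (∑ b, limitWeight γ β m b * -((action γ m (truncPath (α i)) b : ℂ) ^ 2 / 2)) with hX
    set κ : ℕ → ℝ := fun n => ∑ a : ContourPath (m + 1), ∑ b : ContourPath (m + 1),
      ‖skPhase μ n (action γ (m + 1) a b) - 1‖ with hκ
    have hκ0 : ∀ n, 0 ≤ κ n := fun n =>
      Finset.sum_nonneg fun _ _ => Finset.sum_nonneg fun _ _ => norm_nonneg _
    have hκ1 : Tendsto κ atTop (𝓝 0) := by
      have := tendsto_finsetSum Finset.univ fun (a : ContourPath (m + 1)) _ =>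
        tendsto_finsetSum Finset.univ fun (b : ContourPath (m + 1)) _ =>
          tendsto_skPhase h0 h1 (action γ (m + 1) a b)
      simpa using this
    -- The number of unordered pairs from U, diagonal included; it bounds the number of edges within
    -- U.
    set N : ℕ := (k + 1).choose 2 with hN
    set η : ℕ → ℝ := fun n => Real.exp (N * κ n) - 1 with hη
    have hη0 : ∀ n, 0 ≤ η n := fun n => by
      have : 0 ≤ N * κ n := mul_nonneg (Nat.cast_nonneg _) (hκ0 n)
      simpa [hη] using this
    have hη1 : Tendsto η atTop (𝓝 0) := by
      have h2 := (Real.continuous_exp.tendsto _).comp (hκ1.const_mul (N : ℝ))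
      have h3 := h2.sub_const 1
      simpa using h3
    set τ : (Fin k → ContourPath (m + 1)) → ℕ → ℝ := fun α n =>
      ‖∏ i, siteWeight β (m + 1) (α i)‖ * (η n * (‖X α‖ + ε α n) + ε α n) with hτ
    have hτ0 : ∀ α n, 0 ≤ τ α n := fun α n => mul_nonneg (norm_nonneg _)
      (add_nonneg (mul_nonneg (hη0 n) (add_nonneg (norm_nonneg _) (hε0 α n))) (hε0 α n))
    refine ⟨fun n => ∑ α, τ α n, fun n => Finset.sum_nonneg fun α _ => hτ0 α n, ?_, ?_⟩
    · have : ∀ α, Tendsto (τ α) atTop (𝓝 0) := by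
        intro α
        have h2 := ((hη1.mul ((hε1 α).const_add ‖X α‖)).add (hε1 α)).const_mul
          ‖∏ i, siteWeight β (m + 1) (α i)‖
        rwa [zero_mul, add_zero, mul_zero] at h2
      simpa using tendsto_finsetSum Finset.univ fun α _ => this α
    intro n hn A U hA hU hAU a
    obtain ⟨α, hα⟩ := exists_prod_eq_prod_fin U hU a
    -- Summing the error over all tuples α makes it independent of the one realized by a.
    refine le_trans ?_ (Finset.single_le_sum (f := fun α => τ α n) (fun α _ => hτ0 α n)
      (Finset.mem_univ α))
    have h2 := hε2 α n hn A U hA hU hAU a hα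
    rw [contourSum_succ_indicator, edgesAvoiding_filter]
    set CS := contourSum γ β (edgesAvoiding (⊤ : SimpleGraph (Fin n)) (A ∪ U))
      (fun _ => skPhase μ n) m (fun c => ∏ u ∈ U, ∏ x with x ∉ U ∧ s(u, x) ∈ edgesAvoiding ⊤ A,
        skPhase μ n (action γ m (truncPath (a u)) (c x)))
    have h3 : ∏ u ∈ U, limitWeight γ β (m + 1) (a u) =
        (∏ u ∈ U, siteWeight β (m + 1) (a u)) * X α := by
      rw [hX]
      simp only
      rw [← hα fun a' => Complex.exp (∑ b, limitWeight γ β m b *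
        -((action γ m (truncPath a') b : ℂ) ^ 2 / 2)), ← Finset.prod_mul_distrib]
      rfl
    set P := ∏ e ∈ edgesWithin (edgesAvoiding (⊤ : SimpleGraph (Fin n)) A) U,
      skPhase μ n (pairAction γ (m + 1) a e)
    have h4 : ‖P - 1‖ ≤ η n := by
      have h5 := Finset.norm_prod_one_add_sub_one_le
        (edgesWithin (edgesAvoiding (⊤ : SimpleGraph (Fin n)) A) U)
        (fun e => skPhase μ n (pairAction γ (m + 1) a e) - 1)
      simp only [add_sub_cancel] at h5
      refine h5.trans (sub_le_sub_right (Real.exp_le_exp.2 ?_) 1)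
      have h6 : ∀ e ∈ edgesWithin (edgesAvoiding (⊤ : SimpleGraph (Fin n)) A) U,
          ‖skPhase μ n (pairAction γ (m + 1) a e) - 1‖ ≤ κ n := by
        intro e _
        induction e using Sym2.ind with
        | _ u v =>
          rw [pairAction_mk]
          refine le_trans ?_ (Finset.single_le_sum (f := fun a' => ∑ b : ContourPath (m + 1),
            ‖skPhase μ n (action γ (m + 1) a' b) - 1‖)
            (fun _ _ => Finset.sum_nonneg fun _ _ => norm_nonneg _) (Finset.mem_univ (a u)))
          exact Finset.single_le_sum (f := fun b => ‖skPhase μ n (action γ (m + 1) (a u) b) - 1‖)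
            (fun _ _ => norm_nonneg _) (Finset.mem_univ (a v))
      refine (Finset.sum_le_card_nsmul _ _ _ h6).trans ?_
      rw [nsmul_eq_mul]
      refine mul_le_mul_of_nonneg_right ?_ (hκ0 n)
      have h7 := edgesWithin_subset_sym2 (edgesAvoiding (⊤ : SimpleGraph (Fin n)) A) U
      have h8 := Finset.card_le_card h7
      rw [Finset.card_sym2, hU] at h8
      exact_mod_cast h8
    have h5 : ‖CS‖ ≤ ‖X α‖ + ε α n := by
      have := norm_add_le (X α) (CS - X α)
      rw [add_sub_cancel] at this
      linarith
    rw [h3, hα (siteWeight β (m + 1))]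
    have h6 : (∏ i, siteWeight β (m + 1) (α i)) * P * CS -
        (∏ i, siteWeight β (m + 1) (α i)) * X α =
        (∏ i, siteWeight β (m + 1) (α i)) * ((P - 1) * CS + (CS - X α)) := by ring
    rw [h6, norm_mul]
    refine mul_le_mul_of_nonneg_left ?_ (norm_nonneg _)
    refine (norm_add_le _ _).trans (add_le_add ?_ h2)
    rw [norm_mul]
    exact mul_le_mul h4 h5 (norm_nonneg _) (hη0 n)

end

end

noncomputable section

/-! ### Energies -/

/-! ### Two-qubit observables and the cut fraction. -/

section Pairs

variable {V : Type} [Fintype V] [DecidableEq V]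

theorem contourSum_congr (γ β : ℕ → ℝ) (E : Finset (Sym2 V)) {w w' : Sym2 V → ℝ → ℂ} (m : ℕ)
    (h : ∀ e ∈ E, w e = w' e) (F : (V → ContourPath m) → ℂ) :
    contourSum γ β E w m F = contourSum γ β E w' m F := by
  refine Finset.sum_congr rfl fun c _ => ?_
  have : ∏ e ∈ E, w e (pairAction γ m c e) = ∏ e ∈ E, w' e (pairAction γ m c e) :=
    Finset.prod_congr rfl fun e he => by rw [h e he]
  rw [this]

/-- An observable of two qubits is a combination of indicators. -/
theorem contourSum_pair (γ β : ℕ → ℝ) (E : Finset (Sym2 V)) (w : Sym2 V → ℝ → ℂ) (m : ℕ) {u v : V}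
    (huv : u ≠ v) (H : ContourPath m → ContourPath m → ℂ) :
    contourSum γ β E w m (fun c => H (c u) (c v)) = ∑ a, ∑ b, H a b *
      contourSum γ β E w m (pathIndicator {u, v} fun x => if x = u then a else b) := by
  simp only [← contourSum_const_mul, ← contourSum_sum]
  congr 1
  funext c
  have : ∀ a b, pathIndicator {u, v} (fun x => if x = u then a else b) c =
      (if c u = a then 1 else 0) * if c v = b then 1 else 0 := by
    intro a b
    by_cases ha : c u = a <;> simp [pathIndicator, huv.symm, ha]
  simp [this]

theorem expect_sub_mul (ψ : (V → ℤˣ) → ℂ) (hψ : ∑ z, ‖ψ z‖ ^ 2 = 1) {ι : Type*} (s : Finset ι)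
    (F : ι → (V → ℤˣ) → ℝ) :
    expect ψ (fun z => ∑ i ∈ s, (1 / 2 : ℝ) * (1 - F i z)) =
      ∑ i ∈ s, (1 / 2 : ℝ) * (1 - expect ψ (F i)) := by
  simp only [expect, Finset.mul_sum]
  rw [Finset.sum_comm]
  refine Finset.sum_congr rfl fun i _ => ?_
  calc ∑ z, ‖ψ z‖ ^ 2 * ((1 / 2 : ℝ) * (1 - F i z)) =
      1 / 2 * ∑ z, (‖ψ z‖ ^ 2 - ‖ψ z‖ ^ 2 * F i z) := by
        rw [Finset.mul_sum]
        exact Finset.sum_congr rfl fun z _ => by ring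
    _ = _ := by rw [Finset.sum_sub_distrib, hψ]

theorem expect_edge_largeGirth (γ β : ℕ → ℝ) (D p : ℕ) (G : SimpleGraph V) [DecidableRel G.Adj]
    (hG : G.IsRegularOfDegree (D + 1)) (hp : ((2 * p + 1 : ℕ) : ℕ∞) < G.egirth) {u v : V}
    (huv : G.Adj u v) :
    (expect (qaoaState (driverCost G D) p (fun k => γ k) (fun k => β k))
      (fun z => signVal (z u) * signVal (z v)) : ℂ) = edgeCorrelation γ β D p := by
  have h1 : driverCost G D = fun z => ∑ e ∈ G.edgeFinset, -(1 / Real.sqrt D) * edgeProd z e := by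
    funext z
    rw [driverCost, Finset.mul_sum]
  rw [h1, expect_qaoaState γ β G.edgeFinset (fun _ => -(1 / Real.sqrt D)) p]
  change contourSum γ β G.edgeFinset (fun _ => driverPhase D) p _ = _
  have h2 := contourSum_pair γ β G.edgeFinset (fun _ => driverPhase D) p huv.ne
    (fun a b => ((signVal (a.1 (Fin.last p)) * signVal (b.1 (Fin.last p)) : ℝ) : ℂ))
  rw [h2, edgeCorrelation]
  refine Finset.sum_congr rfl fun a _ => Finset.sum_congr rfl fun b _ => ?_
  rw [contourSum_edge γ β (driverPhase D) (driverPhase_zero D) D G hG p hp huv, if_pos rfl,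
    if_neg huv.ne']
  push_cast
  ring

end Pairs

theorem isLargeGirthValue (γ β : ℕ → ℝ) (p D : ℕ) (hD : 1 ≤ D) :
    IsLargeGirthValue (p := p) (fun k => γ k) (fun k => β k) D
      (-(1 / 2 : ℂ) * ((Real.sqrt D : ℂ) * edgeCorrelation γ β D p)).re := by
  intro V _ _ G _ hG hp u v huv
  set x := (-(1 / 2 : ℂ) * ((Real.sqrt D : ℂ) * edgeCorrelation γ β D p)).re with hx
  have hD' : (0 : ℝ) < Real.sqrt D := Real.sqrt_pos.2 (by exact_mod_cast hD)
  have key : ∀ u v : V, G.Adj u v →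
      expect (qaoaState (driverCost G D) p (fun k => γ k) (fun k => β k))
        (fun z => signVal (z u) * signVal (z v)) = -(2 * x / Real.sqrt D) := by
    intro u v huv
    have h1 := congrArg Complex.re (expect_edge_largeGirth γ β D p G hG hp huv)
    rw [Complex.ofReal_re] at h1
    have h2 : x = -(1 / 2) * (Real.sqrt D * (edgeCorrelation γ β D p).re) := by
      rw [hx, show (-(1 / 2 : ℂ)) = ((-(1 / 2) : ℝ) : ℂ) by push_cast; ring, Complex.re_ofReal_mul,
        Complex.re_ofReal_mul]
    rw [h1, h2]
    field_simp
  refine ⟨by rw [key u v huv]; ring, ?_⟩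
  have h3 : maxCutCost G = fun z => ∑ e ∈ G.edgeFinset, (1 / 2 : ℝ) * (1 - edgeProd z e) := rfl
  rw [h3, expect_sub_mul _ (sum_norm_sq_qaoaState _ _ _ _) _ fun e z => edgeProd z e]
  have h4 : ∀ e ∈ G.edgeFinset, (1 / 2 : ℝ) * (1 - expect (qaoaState (driverCost G D) p
      (fun k => γ k) (fun k => β k)) fun z => edgeProd z e) = 1 / 2 + x / Real.sqrt D := by
    intro e he
    induction e using Sym2.ind with
    | _ s t =>
      rw [SimpleGraph.mem_edgeFinset, SimpleGraph.mem_edgeSet] at he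
      have := key s t he
      change (1 / 2 : ℝ) * (1 - expect _ fun z => signVal (z s) * signVal (z t)) = _
      rw [this]
      ring
  rw [Finset.sum_congr rfl h4, Finset.sum_const, nsmul_eq_mul]
  have h5 : (G.edgeFinset.card : ℝ) ≠ 0 := by
    have : 0 < G.edgeFinset.card :=
      Finset.card_pos.2 ⟨s(u, v), by rwa [SimpleGraph.mem_edgeFinset, SimpleGraph.mem_edgeSet]⟩
    exact_mod_cast this.ne'
  rw [mul_div_cancel_left₀ _ h5]

/-- The phase weights of the averaged model with one coupling inserted for the pair `e'`. -/
def insertedPhase (μ : Measure ℝ) (n : ℕ) (e' e : Sym2 (Fin n)) (x : ℝ) : ℂ :=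
  if e = e' then couplingPhase μ (x / Real.sqrt n) else skPhase μ n x

/-- The coupling of the measured pair e' is absorbed into the pair factor of e', so the summand
stays a product over pairs and the average still factorizes. -/
theorem skEnergy_eq (γ β : ℕ → ℝ) (p n : ℕ) (J : Pairs n → ℝ) :
    (skEnergy (p := p) (fun k => γ k) (fun k => β k) n J : ℂ) =
      ∑ e' ∈ skEdges n, ((n : ℂ) * Real.sqrt n)⁻¹ * contourSum γ β (skEdges n)
        (fun e x => (if e = e' then (couplingOf J e : ℂ) else 1) *
          Complex.exp (-(Complex.I * ((couplingOf J e * (x / Real.sqrt n) : ℝ) : ℂ)))) p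
        (fun c => (edgeProd (fun v => (c v).1 (Fin.last p)) e' : ℂ)) := by
  rw [skEnergy, show skCost n J = fun z => ∑ e ∈ skEdges n,
    (couplingOf J e / Real.sqrt n) * edgeProd z e from funext (skCost_eq n J),
    expect_qaoaState γ β (skEdges n) (fun e => couplingOf J e / Real.sqrt n) p]
  simp only [contourSum, Finset.mul_sum]
  rw [Finset.sum_comm]
  refine Finset.sum_congr rfl fun c _ => ?_
  push_cast
  rw [Finset.sum_div, Finset.mul_sum]
  refine Finset.sum_congr rfl fun e' he' => ?_
  rw [Finset.prod_mul_distrib, Finset.prod_ite_eq', if_pos he']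
  have : ∀ e x, Complex.exp (-(Complex.I * ((couplingOf J e : ℂ) * ((x : ℂ) / Real.sqrt n)))) =
      Complex.exp (-(Complex.I * ((couplingOf J e : ℂ) / Real.sqrt n * (x : ℂ)))) := by
    intro e x
    congr 1
    ring
  simp only [this]
  ring

/-! ### The averaged energy per qubit. -/

section SherringtonKirkpatrick

variable {μ : Measure ℝ} [IsProbabilityMeasure μ]

theorem integral_skEnergy (hμ : MemLp (fun x : ℝ => x) 2 μ) (γ β : ℕ → ℝ) (p n : ℕ) :
    Integrable (skEnergy (p := p) (fun k => γ k) (fun k => β k) n) (couplingLaw μ n) ∧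
    ((∫ J, skEnergy (p := p) (fun k => γ k) (fun k => β k) n J ∂(couplingLaw μ n) : ℝ) : ℂ) =
      ∑ e' ∈ skEdges n, ((n : ℂ) * Real.sqrt n)⁻¹ * contourSum γ β (skEdges n)
        (insertedPhase μ n e') p
        (fun c => (edgeProd (fun v => (c v).1 (Fin.last p)) e' : ℂ)) := by
  have h1 := fun e' : Sym2 (Fin n) => integral_contourSum μ γ β (Finset.Subset.refl (skEdges n))
    (fun e y x => (if e = e' then (y : ℂ) else 1) *
      Complex.exp (-(Complex.I * ((y * (x / Real.sqrt n) : ℝ) : ℂ)))) (fun e x => by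
        split_ifs
        · exact integrable_mul_exp_neg_I_mul hμ _
        · simpa only [one_mul] using integrable_exp_neg_I_mul μ _) p
    (fun c => (edgeProd (fun v => (c v).1 (Fin.last p)) e' : ℂ))
  have h2 : Integrable (fun J => (skEnergy (p := p) (fun k => γ k) (fun k => β k) n J : ℂ))
      (couplingLaw μ n) := by
    simp only [skEnergy_eq]
    exact integrable_finsetSum _ fun e' _ => (h1 e').1.const_mul _
  refine ⟨by simpa using h2.re, ?_⟩
  rw [← integral_complex_ofReal]
  simp only [skEnergy_eq]
  rw [integral_finsetSum _ fun e' _ => (h1 e').1.const_mul _]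
  refine Finset.sum_congr rfl fun e' _ => ?_
  rw [integral_const_mul, (h1 e').2]
  congr 1
  refine contourSum_congr γ β _ p (fun e _ => ?_) _
  funext x
  simp only [insertedPhase]
  split_ifs
  · rfl
  · simp only [one_mul]
    rfl

/-- Freezing i and j isolates the inserted coupling in the one pair between them, which gives -ix/√n
to leading order; the rest is the ordinary averaged model, treated by `contourSum_crossing` with K =
0 and k = 2. -/
theorem exists_bound_insertedPhase_indicator (hμ : MemLp (fun x : ℝ => x) 2 μ)
    (h0 : ∫ x, x ∂μ = 0) (h1 : ∫ x, x ^ 2 ∂μ = 1) (γ β : ℕ → ℝ) (p : ℕ) (a b : ContourPath p) :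
    ∃ ε : ℕ → ℝ, Tendsto ε atTop (𝓝 0) ∧ ∀ n, 0 < n → ∀ i j : Fin n, i ≠ j →
      ‖(Real.sqrt n : ℂ) * contourSum γ β (skEdges n) (insertedPhase μ n s(i, j)) p
        (pathIndicator {i, j} fun x => if x = i then a else b) -
        limitWeight γ β p a * limitWeight γ β p b * -(Complex.I * action γ p a b)‖ ≤ ε n := by
  cases p with
  | zero =>
    refine ⟨fun _ => 0, tendsto_const_nhds, fun n hn i j hij => ?_⟩
    have h2 : ∏ e ∈ skEdges n, insertedPhase μ n s(i, j) e 0 = 0 := by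
      refine Finset.prod_eq_zero (i := s(i, j)) ?_ ?_
      · rwa [SimpleGraph.mem_edgeFinset, SimpleGraph.mem_edgeSet, SimpleGraph.top_adj]
      · rw [insertedPhase, if_pos rfl, zero_div, couplingPhase_zero h0]
    have h3 : limitWeight γ β 0 a * limitWeight γ β 0 b * -(Complex.I * action γ 0 a b) = 0 := by
      simp only [limitWeight]
      by_cases ha : siteWeight β 0 a = 0
      · simp [ha]
      by_cases hb : siteWeight β 0 b = 0
      · simp [hb]
      rw [action_zero_layers γ (siteWeight_ne_zero ha) (siteWeight_ne_zero hb)]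
      simp
    rw [contourSum_zero_indicator, h2, h3]
    simp
  | succ m =>
    obtain ⟨ε, hε0, hε1, hε2⟩ :=
      (asymptoticallyIndependent h0 h1 γ β m).contourSum_crossing h0 h1 0 2 ![a, b]
    set X : ℂ := ∏ i, Complex.exp (∑ b', limitWeight γ β m b' *
      -((action γ m (truncPath ((![a, b] : Fin 2 → ContourPath (m + 1)) i)) b' : ℂ) ^ 2 / 2))
      with hX
    set y : ℕ → ℂ := fun n =>
      (Real.sqrt n : ℂ) * couplingPhase μ (action γ (m + 1) a b / Real.sqrt n) with hy
    have hylim : Tendsto y atTop (𝓝 (-(Complex.I * action γ (m + 1) a b))) :=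
      tendsto_sqrt_mul_couplingPhase hμ h0 h1 _
    set P : ℂ := siteWeight β (m + 1) a * siteWeight β (m + 1) b with hP
    refine ⟨fun n => ‖P‖ * (‖y n‖ * ε n + ‖y n - -(Complex.I * action γ (m + 1) a b)‖ * ‖X‖),
      ?_, fun n hn i j hij => ?_⟩
    · have h2 := (tendsto_iff_norm_sub_tendsto_zero.1 hylim).mul_const ‖X‖
      have h3 := ((hylim.norm.mul hε1).add h2).const_mul ‖P‖
      rwa [mul_zero, zero_mul, add_zero, mul_zero] at h3
    have hadj : (⊤ : SimpleGraph (Fin n)).Adj i j := hij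
    set c₀ : Fin n → ContourPath (m + 1) := fun x => if x = i then a else b with hc₀
    have hi : c₀ i = a := if_pos rfl
    have hj : c₀ j = b := if_neg hij.symm
    have h2 := hε2 n hn ∅ {i, j} Finset.card_empty (Finset.card_pair hij) (by simp) c₀ (fun h => by
      rw [Finset.prod_pair hij, Fin.prod_univ_two, hi, hj]
      rfl)
    have hE : skEdges n = edgesAvoiding (⊤ : SimpleGraph (Fin n)) ∅ := by
      ext e
      induction e using Sym2.ind with
      | _ s t =>
        rw [SimpleGraph.mem_edgeFinset, SimpleGraph.mem_edgeSet, mk_mem_edgesAvoiding]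
        simp
    -- The pair ij neither avoids nor crosses {i, j}, so the insertion is invisible here.
    have hcs : contourSum γ β (edgesAvoiding ⊤ (∅ ∪ {i, j})) (insertedPhase μ n s(i, j)) m
        (fun c => ∏ u ∈ {i, j}, ∏ x with x ∉ ({i, j} : Finset (Fin n)) ∧ s(u, x) ∈ edgesAvoiding ⊤ ∅,
          insertedPhase μ n s(i, j) s(u, x) (action γ m (truncPath (c₀ u)) (c x))) =
        contourSum γ β (edgesAvoiding ⊤ (∅ ∪ {i, j})) (fun _ => skPhase μ n) m
        (fun c => ∏ u ∈ {i, j}, ∏ x with x ∉ ({i, j} : Finset (Fin n)) ∧ s(u, x) ∈ edgesAvoiding ⊤ ∅,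
          skPhase μ n (action γ m (truncPath (c₀ u)) (c x))) := by
      rw [contourSum_congr γ β _ m (w' := fun _ => skPhase μ n)]
      · congr 1
        funext c
        refine Finset.prod_congr rfl fun u _ => Finset.prod_congr rfl fun x hx => ?_
        have hx' := (Finset.mem_filter.1 hx).2.1
        rw [insertedPhase, if_neg]
        intro h
        have : x ∈ s(i, j) := h ▸ Sym2.mem_mk_right u x
        exact hx' (by simpa using this)
      · intro e he
        funext x
        rw [insertedPhase, if_neg]
        rintro rfl
        exact (mk_mem_edgesAvoiding.1 he).2.1 (by simp)
    rw [hE, contourSum_succ_indicator, edgesAvoiding_filter, hcs, edgesWithin_pair hadj,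
      Finset.prod_singleton, Finset.prod_pair hij, pairAction_mk, hi, hj, insertedPhase, if_pos rfl]
    set CS := contourSum γ β (edgesAvoiding (⊤ : SimpleGraph (Fin n)) (∅ ∪ {i, j}))
      (fun _ => skPhase μ n) m
      (fun c => ∏ u ∈ {i, j}, ∏ x with x ∉ ({i, j} : Finset (Fin n)) ∧ s(u, x) ∈ edgesAvoiding ⊤ ∅,
          skPhase μ n (action γ m (truncPath (c₀ u)) (c x)))
    have h3 : limitWeight γ β (m + 1) a * limitWeight γ β (m + 1) b = P * X := by
      rw [hX, Fin.prod_univ_two, hP]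
      simp only [limitWeight, Matrix.cons_val_zero, Matrix.cons_val_one]
      ring
    rw [h3]
    have h4 : (Real.sqrt n : ℂ) * (siteWeight β (m + 1) a * siteWeight β (m + 1) b *
        couplingPhase μ (action γ (m + 1) a b / Real.sqrt n) * CS) -
        P * X * -(Complex.I * action γ (m + 1) a b) =
        P * (y n * (CS - X) + (y n - -(Complex.I * action γ (m + 1) a b)) * X) := by
      rw [hy, hP]
      ring
    rw [h4, norm_mul]
    refine mul_le_mul_of_nonneg_left ((norm_add_le _ _).trans ?_) (norm_nonneg _)
    rw [norm_mul (y n), norm_mul (y n - _)]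
    exact add_le_add (mul_le_mul_of_nonneg_left h2 (norm_nonneg _)) le_rfl

theorem norm_signVal (s : ℤˣ) : ‖(signVal s : ℂ)‖ = 1 := by
  rcases Int.units_eq_one_or s with rfl | rfl <;> simp [signVal]

theorem exists_bound_insertedPhase (hμ : MemLp (fun x : ℝ => x) 2 μ)
    (h0 : ∫ x, x ∂μ = 0) (h1 : ∫ x, x ^ 2 ∂μ = 1) (γ β : ℕ → ℝ) (p : ℕ) :
    ∃ ε : ℕ → ℝ, Tendsto ε atTop (𝓝 0) ∧ ∀ n, 0 < n → ∀ e ∈ skEdges n,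
      ‖(Real.sqrt n : ℂ) * contourSum γ β (skEdges n) (insertedPhase μ n e) p
        (fun c => (edgeProd (fun v => (c v).1 (Fin.last p)) e : ℂ)) -
        -limitCorrelation γ β p‖ ≤ ε n := by
  choose ε hε1 hε2 using exists_bound_insertedPhase_indicator hμ h0 h1 γ β p
  refine ⟨fun n => ∑ a, ∑ b, ε a b n, ?_, fun n hn e he => ?_⟩
  · have := tendsto_finsetSum Finset.univ fun a _ => tendsto_finsetSum Finset.univ fun b _ =>
      hε1 a b
    simpa using this
  induction e using Sym2.ind with
  | _ i j =>
    rw [SimpleGraph.mem_edgeFinset, SimpleGraph.mem_edgeSet, SimpleGraph.top_adj] at he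
    have h2 := contourSum_pair γ β (skEdges n) (insertedPhase μ n s(i, j)) p he
      (fun a b => ((signVal (a.1 (Fin.last p)) * signVal (b.1 (Fin.last p)) : ℝ) : ℂ))
    change ‖(Real.sqrt n : ℂ) * contourSum γ β (skEdges n) (insertedPhase μ n s(i, j)) p
      (fun c => ((signVal ((c i).1 (Fin.last p)) * signVal ((c j).1 (Fin.last p)) : ℝ) : ℂ)) - _‖ ≤ _
    rw [h2, limitCorrelation, Finset.mul_sum, ← Finset.sum_neg_distrib, ← Finset.sum_sub_distrib]
    refine (norm_sum_le _ _).trans (Finset.sum_le_sum fun a _ => ?_)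
    rw [Finset.mul_sum, ← Finset.sum_neg_distrib, ← Finset.sum_sub_distrib]
    refine (norm_sum_le _ _).trans (Finset.sum_le_sum fun b _ => ?_)
    refine le_trans (le_of_eq ?_) (hε2 a b n hn i j he)
    rw [← one_mul ‖(Real.sqrt n : ℂ) * _ - limitWeight γ β p a * _ * _‖]
    have h3 : ‖((signVal (a.1 (Fin.last p)) * signVal (b.1 (Fin.last p)) : ℝ) : ℂ)‖ = 1 := by
      rw [Complex.ofReal_mul, norm_mul, norm_signVal, norm_signVal, mul_one]
    rw [← h3, ← norm_mul]
    congr 1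
    push_cast
    ring

theorem tendsto_card_skEdges_div :
    Tendsto (fun n : ℕ => ((skEdges n).card : ℂ) / (n : ℂ) ^ 2) atTop (𝓝 (1 / 2)) := by
  have h1 : Tendsto (fun n : ℕ => (1 - ((n : ℂ))⁻¹) / 2) atTop (𝓝 (1 / 2)) := by
    have h2 : Tendsto (fun n : ℕ => ((n : ℂ))⁻¹) atTop (𝓝 0) := tendsto_inv_atTop_nhds_zero_nat
    simpa using (h2.const_sub 1).div_const 2
  refine h1.congr' ?_
  filter_upwards [eventually_gt_atTop 0] with n hn
  have hn' : (n : ℂ) ≠ 0 := by exact_mod_cast hn.ne'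
  rw [SimpleGraph.card_edgeFinset_top_eq_card_choose_two, Fintype.card_fin, Nat.cast_choose_two]
  field_simp

theorem tendsto_integral_skEnergy (hμ : MemLp (fun x : ℝ => x) 2 μ)
    (h0 : ∫ x, x ∂μ = 0) (h1 : ∫ x, x ^ 2 ∂μ = 1) (γ β : ℕ → ℝ) (p : ℕ) :
    Tendsto (fun n : ℕ => ∫ J, skEnergy (p := p) (fun k => γ k) (fun k => β k) n J
      ∂(couplingLaw μ n)) atTop (𝓝 (-(1 / 2 : ℂ) * limitCorrelation γ β p).re) := by
  obtain ⟨ε, hε1, hε2⟩ := exists_bound_insertedPhase hμ h0 h1 γ β p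
  set L := limitCorrelation γ β p with hL
  set W : (n : ℕ) → Sym2 (Fin n) → ℂ := fun n e => contourSum γ β (skEdges n)
    (insertedPhase μ n e) p (fun c => (edgeProd (fun v => (c v).1 (Fin.last p)) e : ℂ)) with hW
  have h2 : Tendsto (fun n : ℕ => ((∫ J, skEnergy (p := p) (fun k => γ k) (fun k => β k) n J
      ∂(couplingLaw μ n) : ℝ) : ℂ)) atTop (𝓝 (-(1 / 2 : ℂ) * L)) := by
    have h3 : Tendsto (fun n : ℕ => ((skEdges n).card : ℂ) / (n : ℂ) ^ 2 * -L) atTop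
        (𝓝 (-(1 / 2 : ℂ) * L)) := by
      have := tendsto_card_skEdges_div.mul_const (-L)
      rwa [show (1 / 2 : ℂ) * -L = -(1 / 2) * L by ring] at this
    have h4 : Tendsto (fun n : ℕ => ((∫ J, skEnergy (p := p) (fun k => γ k) (fun k => β k) n J
        ∂(couplingLaw μ n) : ℝ) : ℂ) - ((skEdges n).card : ℂ) / (n : ℂ) ^ 2 * -L) atTop (𝓝 0) := by
      rw [tendsto_zero_iff_norm_tendsto_zero]
      have h5 := (tendsto_card_skEdges_div.norm).mul hε1
      rw [mul_zero] at h5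
      refine squeeze_zero' (Eventually.of_forall fun _ => norm_nonneg _) ?_ h5
      filter_upwards [eventually_gt_atTop 0] with n hn
      have hn' : (n : ℂ) ≠ 0 := by exact_mod_cast hn.ne'
      have hs' : (Real.sqrt n : ℂ) ≠ 0 := by
        exact_mod_cast (Real.sqrt_pos.2 (by exact_mod_cast hn : (0 : ℝ) < n)).ne'
      have hss : (Real.sqrt n : ℂ) * Real.sqrt n = n := by
        rw [← Complex.ofReal_mul, Real.mul_self_sqrt (Nat.cast_nonneg n)]
        simp
      -- This gives each of the roughly n²/2 pairs the weight 1/n² and leaves the factor √n under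
      -- which the pair terms converge.
      have h6 : ((n : ℂ) * Real.sqrt n)⁻¹ = ((n : ℂ) ^ 2)⁻¹ * Real.sqrt n := by
        field_simp
        rw [sq, hss]
      rw [(integral_skEnergy hμ γ β p n).2]
      have h7 : ∑ e ∈ skEdges n, ((n : ℂ) * Real.sqrt n)⁻¹ * W n e -
          ((skEdges n).card : ℂ) / (n : ℂ) ^ 2 * -L =
          ((n : ℂ) ^ 2)⁻¹ * ∑ e ∈ skEdges n, ((Real.sqrt n : ℂ) * W n e - -L) := by
        rw [Finset.sum_sub_distrib, Finset.sum_const, nsmul_eq_mul, mul_sub, Finset.mul_sum]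
        congr 1
        · exact Finset.sum_congr rfl fun e _ => by rw [h6]; ring
        · ring
      rw [h7, norm_mul]
      calc ‖((n : ℂ) ^ 2)⁻¹‖ * ‖∑ e ∈ skEdges n, ((Real.sqrt n : ℂ) * W n e - -L)‖
          ≤ ‖((n : ℂ) ^ 2)⁻¹‖ * ((skEdges n).card * ε n) := by
            refine mul_le_mul_of_nonneg_left ((norm_sum_le _ _).trans ?_) (norm_nonneg _)
            refine (Finset.sum_le_card_nsmul _ _ _ (hε2 n hn)).trans ?_
            rw [nsmul_eq_mul]
        _ = ‖((skEdges n).card : ℂ) / (n : ℂ) ^ 2‖ * ε n := by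
            rw [div_eq_mul_inv, norm_mul, Complex.norm_natCast]
            ring
    have := h4.add h3
    simpa using this
  have h3 := (Complex.continuous_re.tendsto _).comp h2
  exact h3.congr fun n => Complex.ofReal_re _

end SherringtonKirkpatrick

end

theorem theorem1 (p : ℕ) (γ β : Fin p → ℝ) :
    ∃ (νD : ℕ → ℝ) (ν : ℝ),
      (∀ D : ℕ, 1 ≤ D → IsLargeGirthValue γ β D (νD D)) ∧
      Tendsto νD atTop (𝓝 ν) ∧
      ∀ (μ : Measure ℝ) [IsProbabilityMeasure μ],
        MemLp (fun x : ℝ => x) 2 μ → ∫ x, x ∂μ = 0 → ∫ x, x ^ 2 ∂μ = 1 →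
          (∀ n : ℕ, Integrable (skEnergy γ β n) (couplingLaw μ n)) ∧
          Tendsto (fun n : ℕ => ∫ J, skEnergy γ β n J ∂(couplingLaw μ n)) atTop (𝓝 ν) := by
  -- The values beyond p are arbitrary, since the state uses only the first p angles.
  have extend : ∀ f : Fin p → ℝ, ∃ g : ℕ → ℝ, (fun k : Fin p => g k) = f := fun f =>
    ⟨fun k => if h : k < p then f ⟨k, h⟩ else 0, by simp⟩
  obtain ⟨γ, rfl⟩ := extend γ
  obtain ⟨β, rfl⟩ := extend β
  refine ⟨fun D => (-(1 / 2 : ℂ) * ((Real.sqrt D : ℂ) * edgeCorrelation γ β D p)).re,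
    (-(1 / 2 : ℂ) * limitCorrelation γ β p).re, fun D hD => isLargeGirthValue γ β p D hD, ?_, ?_⟩
  · exact (Complex.continuous_re.tendsto _).comp ((tendsto_edgeCorrelation γ β p).const_mul _)
  · intro μ _ hμ h0 h1
    exact ⟨fun n => (integral_skEnergy hμ γ β p n).1, tendsto_integral_skEnergy hμ h0 h1 γ β p⟩
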